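/- **PEPS and parent Hamiltonians.** Let $G=(V,E)$ be a finite connected simple graph with physical dimensions $d_v$ ($v\in V$) and bond dimensions $D_e\ge 1$ ($e\in E$). A PEPS on $G$ is given by tensors $A^{(v)}$, each with one physical index $s_v\in\{1,\dots,d_v\}$ and one virtual index $\sigma_e\in\{1,\dots,D_e\}$ for every edge $e$ incident to $v$; its state is $$|\Psi(A)\rangle=\sum_{s}\sum_{\sigma}\prod_{v\in V}A^{(v)}_{s_v,(\sigma_e)_{e\ni v}}\,|s\rangle\in\mathcal H=\bigotimes_{v}\mathbb C^{d_v}.$$ For a region $R\subseteq V$, $\Gamma_R$ maps a tensor $C$ on the virtual indices of the boundary edges of $R$ (exactly one end in $R$) to the vector on $R$ obtained by contracting the tensors $A^{(v)}$, $v\in R$, along the edges inside $R$, and with $C$ along the boundary edges. $R$ is an injective region if $\Gamma_R$ is injective. The PEPS is injective if $V$ has a partition into at least two injective regions (blocks); two blocks are adjacent if an edge of $G$ joins them. Given regions $(R_i)_{i\in\mathcal S}$ ($\mathcal S$ finite), the parent Hamiltonian is $\hat H=\sum_{i\in\mathcal S}\hat H_i$, where $\hat H_i$ acts on $R_i$ as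 the orthogonal projector whose kernel is the support of $\rho_{R_i}=\mathrm{Tr}_{V\setminus R_i}|\Psi(A)\rangle\langle\Psi(A)|$. The interaction range is called sufficiently large if any two adjacent blocks are contained together in some $R_i$. **Interaction graph.** Its vertices are the $i\in\mathcal S$, with $i,j$ adjacent iff $[\hat H_i,\hat H_j]\neq 0$; $d(i,j)$ is its graph distance, $L=\max_{i,j}d(i,j)$ is the linear size, and $D(\hat O,\hat O')=\min\{d(i,j): [\hat O,\hat H_i]\ne0,\ [\hat O',\hat H_j]\neq 0\}$, with $\min\emptyset=\infty$. The gap of $\hat H$ is its smallest nonzero eigenvalue. **Statement.** Consider a sequence, indexed by $n\in\mathbb N$, of injective PEPS on finite connected graphs, with parent Hamiltonians $\hat H^{(n)}$ of sufficiently large interaction range. Assume that the interaction graphs are connected, that their maximum degrees are bounded uniformly in $n$, and that their linear sizes satisfy $L_n\to\infty$. Then for every $n$ the vector $\Psi_n=\Psi(A)$ is nonzero and spans $\ker\hat H^{(n)}$, so that $\hat\Psi_n=\Psi_n/\|\Psi_n\|$ is the unique ground state. Suppose that the ground state has algebraic correlations: there are constants $\alpha\ge0$, $A,B>0$, $k\in\mathbb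 N$ and operators $\hat O_n,\hat O_n'$, each supported on at most $k$ vertices, such that for all large $n$, $D(\hat O_n,\hat O_n')\ge A L_n$ and $$\frac{\bigl|\langle\hat\Psi_n|\hat O_n\hat O_n'|\hat\Psi_n\rangle-\langle\hat\Psi_n|\hat O_n|\hat\Psi_n\rangle\langle\hat\Psi_n|\hat O_n'|\hat\Psi_n\rangle\bigr|}{\|\hat O_n^\dagger\hat\Psi_n\|\,\|\hat O_n'\hat\Psi_n\|}\ \ge\ B L_n^{-\alpha}.$$ Then there is a constant $C$ with $\mathrm{gap}(\hat H^{(n)})\le C(\ln L_n)^2/L_n^2$ for all large $n$. Consequently the dynamical exponent is at least two: if $\mathrm{gap}(\hat H^{(n)})\sim L_n^{-z}$ in the sense that $-\ln\mathrm{gap}(\hat H^{(n)})/\ln L_n\to z$ (so logarithmic corrections are neglected), then $z\ge2$. -/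

import Mathlib

open scoped Matrix InnerProductSpace
open Filter Topology

noncomputable section

/-! ### Local systems, operators acting on a region -/

/-- Configurations (the product basis `|s⟩`) of a system with local dimensions `d`. -/
abbrev Conf {V : Type*} (d : V → ℕ) : Type _ := ∀ v, Fin (d v)

/-- Configurations of the sites in the region `R`. -/
abbrev RegionConf {V : Type*} (d : V → ℕ) (R : Finset V) : Type _ := ∀ v : {v // v ∈ R}, Fin (d v)

/-- Configurations of the sites outside the region `R`. -/
abbrev OutsideConf {V : Type*} (d : V → ℕ) (R : Finset V) : Type _ :=
  ∀ v : {v // v ∉ R}, Fin (d v)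

/-- The Hilbert space `⨂ᵥ ℂ^(d v)`, in its product basis. -/
abbrev StateSpace {V : Type*} (d : V → ℕ) : Type _ := EuclideanSpace ℂ (Conf d)

/-- Glue a configuration inside `R` to one outside `R`. -/
def glue {V : Type*} [DecidableEq V] {d : V → ℕ} {R : Finset V}
    (a : RegionConf d R) (c : OutsideConf d R) : Conf d :=
  fun v => if h : v ∈ R then a ⟨v, h⟩ else c ⟨v, h⟩

/-- The operator `M ⊗ 1` on the whole system, for an operator `M` on the region `R`. -/
def extendOp {V : Type*} [Fintype V] [DecidableEq V] {d : V → ℕ} (R : Finset V)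
    (M : Matrix (RegionConf d R) (RegionConf d R) ℂ) : Matrix (Conf d) (Conf d) ℂ :=
  fun s t => if ∀ v, v ∉ R → s v = t v then M (fun v => s v) (fun v => t v) else 0

/-- The operator `O` acts only on the region `R`. -/
def IsSupportedOn {V : Type*} [Fintype V] [DecidableEq V] {d : V → ℕ}
    (O : Matrix (Conf d) (Conf d) ℂ) (R : Finset V) : Prop :=
  ∃ M, O = extendOp R M

/-- A matrix as an operator on the Hilbert space. -/
abbrev toOp {ι : Type*} [Fintype ι] [DecidableEq ι] (M : Matrix ι ι ℂ) :
    EuclideanSpace ℂ ι →L[ℂ] EuclideanSpace ℂ ι :=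
  Matrix.toEuclideanCLM (n := ι) (𝕜 := ℂ) M

/-- The reduced density matrix `Tr_{V ∖ R} |ψ⟩⟨ψ|`. -/
def reducedDensity {V : Type*} [Fintype V] [DecidableEq V] {d : V → ℕ}
    (ψ : StateSpace d) (R : Finset V) : Matrix (RegionConf d R) (RegionConf d R) ℂ :=
  fun a b => ∑ c : OutsideConf d R, ψ (glue a c) * star (ψ (glue b c))

/-- The support of an operator: the orthogonal complement of its kernel. -/
def opSupport {ι : Type*} [Fintype ι] [DecidableEq ι] (M : Matrix ι ι ℂ) :
    Submodule ℂ (EuclideanSpace ℂ ι) :=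
  (LinearMap.ker (toOp M).toLinearMap)ᗮ

/-- The orthogonal projector on the region `R` whose kernel is the support of the reduced density
matrix of `ψ`. -/
def localProjector {V : Type*} [Fintype V] [DecidableEq V] {d : V → ℕ}
    (ψ : StateSpace d) (R : Finset V) : Matrix (RegionConf d R) (RegionConf d R) ℂ :=
  (Matrix.toEuclideanCLM (n := RegionConf d R) (𝕜 := ℂ)).symm
    (opSupport (reducedDensity ψ R))ᗮ.starProjection

/-- The local terms of the parent Hamiltonian of `ψ` with interaction ranges `R i`. -/
def parentTerm {V S : Type*} [Fintype V] [DecidableEq V] {d : V → ℕ}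
    (ψ : StateSpace d) (R : S → Finset V) (i : S) : Matrix (Conf d) (Conf d) ℂ :=
  extendOp (R i) (localProjector ψ (R i))

/-! ### Sums of local terms: gap, interaction graph, distances -/

/-- The Hamiltonian `∑ i, H i`. -/
def hamiltonian {ι S : Type*} [Fintype S] (H : S → Matrix ι ι ℂ) : Matrix ι ι ℂ := ∑ i, H i

/-- The smallest nonzero eigenvalue. -/
def spectralGap {ι : Type*} [Fintype ι] [DecidableEq ι] (M : Matrix ι ι ℂ) : ℝ :=
  sInf {lam : ℝ | lam ≠ 0 ∧ Module.End.HasEigenvalue (Matrix.toLin' M) (lam : ℂ)}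

/-- The interaction graph: `i` and `j` are adjacent when `[H i, H j] ≠ 0`. -/
def interactionGraph {ι S : Type*} [Fintype ι] (H : S → Matrix ι ι ℂ) : SimpleGraph S where
  Adj i j := ¬ Commute (H i) (H j)
  symm := ⟨fun _ _ h h' => h h'.symm⟩
  loopless := ⟨fun _ h => h (Commute.refl _)⟩

/-- The distance of two operators: the least interaction-graph distance of two local terms of which
the first does not commute with `O` and the second does not commute with `O'`
(`⊤` if there are none). -/
def opDist {ι S : Type*} [Fintype ι] (H : S → Matrix ι ι ℂ) (O O' : Matrix ι ι ℂ) : ℕ∞ :=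
  ⨅ (i : S) (j : S) (_ : ¬ Commute O (H i)) (_ : ¬ Commute O' (H j)),
    (interactionGraph H).edist i j

/-- The linear size: the diameter of the interaction graph. -/
def linearSize {ι S : Type*} [Fintype ι] (H : S → Matrix ι ι ℂ) : ℕ := (interactionGraph H).diam

/-- The normalised connected correlation function of `O` and `O'` in the unit vector `ψ / ‖ψ‖`. -/
def connectedCorrelation {ι : Type*} [Fintype ι] [DecidableEq ι] (ψ : EuclideanSpace ℂ ι)
    (O O' : Matrix ι ι ℂ) : ℝ :=
  let φ : EuclideanSpace ℂ ι := ((‖ψ‖⁻¹ : ℝ) : ℂ) • ψ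
  ‖⟪φ, toOp (O * O') φ⟫_ℂ - ⟪φ, toOp O φ⟫_ℂ * ⟪φ, toOp O' φ⟫_ℂ‖ /
    (‖toOp Oᴴ φ‖ * ‖toOp O' φ‖)

/-- `gap ∼ L ^ (-z)`, up to corrections that are subleading on the logarithmic scale
(in particular up to powers of `log L`). -/
def HasDynamicalExponent (gap L : ℕ → ℝ) (z : ℝ) : Prop :=
  Tendsto (fun n => -Real.log (gap n) / Real.log (L n)) atTop (𝓝 z)

/-! ### Projected entangled pair states -/

/-- The data of a PEPS on the graph `G`: physical dimensions at the vertices, nonzero bond dimensions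
at the edges, and at each vertex a tensor with one physical index and one virtual index for
every incident edge. -/
structure PEPS {V : Type*} (G : SimpleGraph V) where
  physDim : V → ℕ
  bondDim : G.edgeSet → ℕ
  bondDim_pos : ∀ e, 0 < bondDim e
  tensor : ∀ v, Fin (physDim v) → (∀ e : {e : G.edgeSet // v ∈ e.1}, Fin (bondDim e.1)) → ℂ

namespace PEPS

variable {V : Type*} [Fintype V] [DecidableEq V] {G : SimpleGraph V} [DecidableRel G.Adj]

/-- The state `|Ψ(A)⟩` (not normalised). -/
def state (Λ : PEPS G) : StateSpace Λ.physDim :=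
  WithLp.toLp 2 fun s => ∑ σ : (∀ e : G.edgeSet, Fin (Λ.bondDim e)),
    ∏ v, Λ.tensor v (s v) (fun e => σ e.1)

/-- The edges with at least one end in `R`. -/
abbrev TouchingEdge (G : SimpleGraph V) (R : Finset V) : Type _ :=
  {e : G.edgeSet // ∃ v ∈ R, v ∈ e.1}

/-- The edges with exactly one end in `R`. -/
abbrev BoundaryEdge (G : SimpleGraph V) (R : Finset V) : Type _ :=
  {e : TouchingEdge G R // ∃ v, v ∉ R ∧ v ∈ e.1.1}

/-- The map `Γ_R` from boundary tensors to states on `R`: the tensors in `R` are contracted along the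
inner edges of `R`, and with `C` along the boundary edges. -/
def regionMap (Λ : PEPS G) (R : Finset V)
    (C : (∀ e : BoundaryEdge G R, Fin (Λ.bondDim e.1.1)) → ℂ) :
    RegionConf Λ.physDim R → ℂ :=
  fun s => ∑ σ : (∀ e : TouchingEdge G R, Fin (Λ.bondDim e.1)),
    C (fun e => σ e.1) *
      ∏ v : {v // v ∈ R}, Λ.tensor v (s v) (fun e => σ ⟨e.1, v, v.2, e.2⟩)

/-- The region `R` is injective. -/
def InjectiveRegion (Λ : PEPS G) (R : Finset V) : Prop := Function.Injective (Λ.regionMap R)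

/-- A proper covering by disjoint injective regions: a partition of the vertex set into
at least two blocks, each of which is an injective region. These blocks are the
vertices of the super-lattice. A PEPS is injective if it has such a covering. -/
def IsInjectiveCovering (Λ : PEPS G) (P : Finpartition (Finset.univ : Finset V)) : Prop :=
  2 ≤ P.parts.card ∧ ∀ B ∈ P.parts, Λ.InjectiveRegion B

/-- Adjacency in the super-lattice: an edge of `G` joins the two blocks. -/
def BlockAdj (G : SimpleGraph V) (B B' : Finset V) : Prop :=
  B ≠ B' ∧ ∃ v ∈ B, ∃ w ∈ B', G.Adj v w

/-- The interaction ranges are large enough for the super-lattice `P`: any two adjacent blocks lie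
together in one of them. -/
def RangesCover (G : SimpleGraph V) {S : Type*} (R : S → Finset V)
    (P : Finpartition (Finset.univ : Finset V)) : Prop :=
  ∀ B ∈ P.parts, ∀ B' ∈ P.parts, BlockAdj G B B' → ∃ i, B ⊆ R i ∧ B' ⊆ R i

/-- The local terms of the parent Hamiltonian of a PEPS. -/
abbrev term (Λ : PEPS G) {S : Type*} (R : S → Finset V) :
    S → Matrix (Conf Λ.physDim) (Conf Λ.physDim) ℂ :=
  parentTerm Λ.state R

end PEPS

end

/-! # Injective PEPS: unique ground states, and the gap of the parent Hamiltonian -/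

noncomputable section

/-! ### Star projections on a Hilbert space -/

section Projections

set_option linter.unusedSectionVars false

variable {E : Type*} [NormedAddCommGroup E] [InnerProductSpace ℂ E] [CompleteSpace E]

theorem IsStarProjection.inner_apply_self {p : E →L[ℂ] E} (hp : IsStarProjection p) (x : E) :
    ⟪x, p x⟫_ℂ = ((‖p x‖ ^ 2 : ℝ) : ℂ) := by
  have h1 : p (p x) = p x := by
    rw [← mul_apply_eq_comp, hp.isIdempotentElem.eq]
  have h2 := ContinuousLinearMap.adjoint_inner_left p (p x) x
  rw [← ContinuousLinearMap.star_eq_adjoint, hp.isSelfAdjoint.star_eq, h1] at h2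
  rw [← h2, inner_self_eq_norm_sq_to_K]
  push_cast
  rfl

theorem IsStarProjection.norm_sq_apply_add {p : E →L[ℂ] E} (hp : IsStarProjection p) (x : E) :
    ‖p x‖ ^ 2 + ‖(1 - p) x‖ ^ 2 = ‖x‖ ^ 2 := by
  have h1 := hp.inner_apply_self x
  have h2 := hp.one_sub.inner_apply_self x
  have h3 : ⟪x, p x⟫_ℂ + ⟪x, (1 - p) x⟫_ℂ = ⟪x, x⟫_ℂ := by
    rw [← inner_add_right]; simp
  rw [h1, h2, inner_self_eq_norm_sq_to_K] at h3
  exact Complex.ofReal_injective (by simpa using h3)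

theorem IsStarProjection.norm_apply_le {p : E →L[ℂ] E} (hp : IsStarProjection p) (x : E) :
    ‖p x‖ ≤ ‖x‖ := by
  have := hp.norm_sq_apply_add x
  exact le_of_sq_le_sq (by nlinarith [sq_nonneg ‖(1 - p) x‖]) (norm_nonneg _)

variable {S : Type*} (h : S → E →L[ℂ] E)

/-- The ordered product of the complementary projections `1 - h i`, for `i` in the list `l`. -/
def projProd (l : List S) : E →L[ℂ] E := (l.map fun i => 1 - h i).prod

@[simp] theorem projProd_nil : projProd h [] = 1 := rfl

@[simp] theorem projProd_cons (i : S) (l : List S) :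
    projProd h (i :: l) = (1 - h i) * projProd h l := by simp [projProd]

theorem projProd_append (l l' : List S) :
    projProd h (l ++ l') = projProd h l * projProd h l' := by simp [projProd]

theorem star_projProd (hh : ∀ i, IsStarProjection (h i)) (l : List S) :
    star (projProd h l) = projProd h l.reverse := by
  induction l with
  | nil => simp
  | cons i l ih =>
    rw [projProd_cons, star_mul, ih, List.reverse_cons, projProd_append, projProd_cons,
      projProd_nil, mul_one, (hh i).one_sub.isSelfAdjoint.star_eq]

theorem projProd_apply_eq_self {ψ : E} (hψ : ∀ i, h i ψ = 0) (l : List S) :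
    projProd h l ψ = ψ := by
  induction l with
  | nil => simp
  | cons i l ih => simp [ih, hψ]

open Classical in
/-- The norm that is removed by the factor `1 - h j` in `projProd h l x`. -/
def projLoss (x : E) : List S → S → ℝ
  | [], _ => 0
  | i :: l, j => if j = i then ‖h i (projProd h l x)‖ else projLoss x l j

theorem projLoss_nonneg (x : E) (l : List S) (j : S) : 0 ≤ projLoss h x l j := by
  induction l with
  | nil => simp [projLoss]
  | cons i l ih => rw [projLoss]; split_ifs <;> simp [ih]

theorem projLoss_of_notMem (x : E) {l : List S} {j : S} (hj : j ∉ l) : projLoss h x l j = 0 := by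
  induction l with
  | nil => simp [projLoss]
  | cons i l ih =>
    rw [List.mem_cons, not_or] at hj
    rw [projLoss, if_neg hj.1, ih hj.2]

theorem sum_projLoss_sq_le [Fintype S] (hh : ∀ i, IsStarProjection (h i)) (x : E) (l : List S) :
    ∑ j, projLoss h x l j ^ 2 ≤ ‖x‖ ^ 2 - ‖projProd h l x‖ ^ 2 := by
  classical
  induction l with
  | nil => simp [projLoss]
  | cons i l ih =>
    have h1 := (hh i).norm_sq_apply_add (projProd h l x)
    have h2 : ∑ j, projLoss h x (i :: l) j ^ 2 ≤
        ∑ j, (projLoss h x l j ^ 2 + if j = i then ‖h i (projProd h l x)‖ ^ 2 else 0) := by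
      refine Finset.sum_le_sum fun j _ => ?_
      rw [projLoss]
      split_ifs with hj
      · nlinarith [sq_nonneg (projLoss h x l j)]
      · simp
    rw [Finset.sum_add_distrib, Finset.sum_ite_eq' Finset.univ i] at h2
    simp only [Finset.mem_univ, if_true] at h2
    rw [projProd_cons, mul_apply_eq_comp]
    linarith

open Classical in
theorem norm_apply_projProd_le [Fintype S] (hh : ∀ i, IsStarProjection (h i)) (x : E) {l : List S}
    (hl : l.Nodup) {i : S} (hi : i ∈ l) :
    ‖h i (projProd h l x)‖ ≤
      ∑ j ∈ Finset.univ.filter (fun j => ¬ Commute (h i) (h j)), projLoss h x l j := by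
  induction l with
  | nil => simp at hi
  | cons k l ih =>
    rw [List.nodup_cons] at hl
    set y := projProd h l x with hy
    rw [projProd_cons, mul_apply_eq_comp, ← hy]
    by_cases hik : i = k
    · subst hik
      rw [← mul_apply_eq_comp, (hh i).mul_one_sub_self]
      simpa using Finset.sum_nonneg fun j _ => projLoss_nonneg h x _ j
    have hil : i ∈ l := by simpa [hik] using hi
    specialize ih hl.2 hil
    by_cases hc : Commute (h i) (h k)
    · have h1 : h i ((1 - h k) y) = (1 - h k) (h i y) := by
        have : Commute (h i) (1 - h k) := (Commute.one_right _).sub_right hc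
        rw [← mul_apply_eq_comp, this.eq, mul_apply_eq_comp]
      rw [h1]
      refine ((hh k).one_sub.norm_apply_le _).trans (ih.trans_eq ?_)
      refine Finset.sum_congr rfl fun j hj => ?_
      rw [projLoss, if_neg]
      rintro rfl
      exact (Finset.mem_filter.1 hj).2 hc
    · have h1 : h i ((1 - h k) y) = h i y - h i (h k y) := by simp
      rw [h1]
      have hk : k ∈ Finset.univ.filter (fun j => ¬ Commute (h i) (h j)) := by simp [hc]
      rw [← Finset.add_sum_erase _ _ hk] at ih ⊢
      rw [projLoss_of_notMem h x hl.1, zero_add] at ih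
      have h2 : ∑ j ∈ (Finset.univ.filter (fun j => ¬ Commute (h i) (h j))).erase k,
          projLoss h x (k :: l) j = ∑ j ∈ (Finset.univ.filter
            (fun j => ¬ Commute (h i) (h j))).erase k, projLoss h x l j := by
        refine Finset.sum_congr rfl fun j hj => ?_
        rw [projLoss, if_neg (Finset.ne_of_mem_erase hj)]
      rw [h2, projLoss, if_pos rfl]
      calc ‖h i y - h i (h k y)‖ ≤ ‖h i y‖ + ‖h i (h k y)‖ := norm_sub_le _ _
        _ ≤ ‖h i y‖ + ‖h k y‖ := by gcongr; exact (hh i).norm_apply_le _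
        _ ≤ _ := by rw [add_comm]; gcongr

open Classical in
/-- The energy of `projProd h l x` is bounded by the loss of norm. -/
theorem sum_norm_sq_projProd_le [Fintype S] (hh : ∀ i, IsStarProjection (h i)) (x : E) {l : List S}
    (hl : l.Nodup) (hl' : ∀ i, i ∈ l) (g : ℕ)
    (hg : ∀ i, (Finset.univ.filter (fun j => ¬ Commute (h i) (h j))).card ≤ g) :
    ∑ i, ‖h i (projProd h l x)‖ ^ 2 ≤ (g : ℝ) ^ 2 * (‖x‖ ^ 2 - ‖projProd h l x‖ ^ 2) := by
  have h1 : ∀ i, ‖h i (projProd h l x)‖ ^ 2 ≤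
      g * ∑ j, if ¬ Commute (h i) (h j) then projLoss h x l j ^ 2 else 0 := by
    intro i
    rw [← Finset.sum_filter]
    calc _ ≤ (∑ j ∈ Finset.univ.filter (fun j => ¬ Commute (h i) (h j)), projLoss h x l j) ^ 2 := by
          gcongr; exact norm_apply_projProd_le h hh x hl (hl' i)
      _ ≤ _ := sq_sum_le_card_mul_sum_sq
      _ ≤ _ := by gcongr; exact hg i
  calc _ ≤ ∑ i, g * ∑ j, (if ¬ Commute (h i) (h j) then projLoss h x l j ^ 2 else 0) :=
        Finset.sum_le_sum fun i _ => h1 i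
    _ = g * ∑ j, ((Finset.univ.filter (fun i => ¬ Commute (h i) (h j))).card : ℝ) *
          projLoss h x l j ^ 2 := by
        rw [← Finset.mul_sum, Finset.sum_comm]
        congr 1
        refine Finset.sum_congr rfl fun j _ => ?_
        rw [← Finset.sum_filter, Finset.sum_const, nsmul_eq_mul]
    _ ≤ g * ∑ j, (g : ℝ) * projLoss h x l j ^ 2 := by
        gcongr with j
        have := hg j
        simp_rw [commute_iff_eq, eq_comm (a := h j * _)] at this
        simpa only [commute_iff_eq] using this
    _ ≤ _ := by
        rw [← Finset.mul_sum, ← mul_assoc, ← sq]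
        gcongr
        exact sum_projLoss_sq_le h hh x l

end Projections

/-! ### Greedy colouring -/

/-- A finite graph whose degrees are at most `g` has a proper colouring with `g + 1` colours. -/
theorem SimpleGraph.exists_coloring_of_degree_le {S : Type*} [Finite S] (G : SimpleGraph S) (g : ℕ)
    (hg : ∀ i, (G.neighborSet i).ncard ≤ g) : Nonempty (G.Coloring (Fin (g + 1))) := by
  classical
  cases nonempty_fintype S
  have key : ∀ s : Finset S, ∃ c : S → Fin (g + 1), ∀ i ∈ s, ∀ j ∈ s, G.Adj i j → c i ≠ c j := by
    intro s
    induction s using Finset.induction_on with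
    | empty => exact ⟨fun _ => 0, by simp⟩
    | insert a s ha ih =>
      obtain ⟨c, hc⟩ := ih
      have hcard : ((G.neighborSet a).toFinset.image c).card < Fintype.card (Fin (g + 1)) := by
        refine Finset.card_image_le.trans_lt ?_
        rw [← Set.ncard_eq_toFinset_card', Fintype.card_fin]
        exact Nat.lt_succ_of_le (hg a)
      obtain ⟨x, hx⟩ : ∃ x, x ∉ (G.neighborSet a).toFinset.image c := by
        by_contra! hcon
        rw [Finset.eq_univ_of_forall hcon, Finset.card_univ] at hcard
        exact lt_irrefl _ hcard
      have hx' : ∀ j, G.Adj a j → c j ≠ x := fun j hj hjx =>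
        hx (Finset.mem_image.2 ⟨j, by simpa using hj, hjx⟩)
      refine ⟨Function.update c a x, fun i hi j hj hij => ?_⟩
      rcases Finset.mem_insert.1 hi with rfl | hi' <;>
        rcases Finset.mem_insert.1 hj with rfl | hj'
      · exact absurd hij (G.loopless.irrefl _)
      · rw [Function.update_self, Function.update_of_ne hij.ne']
        exact (hx' j hij).symm
      · rw [Function.update_self, Function.update_of_ne hij.ne]
        exact hx' i hij.symm
      · rw [Function.update_of_ne, Function.update_of_ne]
        · exact hc i hi' j hj' hij
        · rintro rfl; exact ha hj'
        · rintro rfl; exact ha hi'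
  obtain ⟨c, hc⟩ := key Finset.univ
  exact ⟨SimpleGraph.Coloring.mk c fun {i j} hij => hc i (Finset.mem_univ _) j (Finset.mem_univ _) hij⟩

section Correlations

set_option linter.unusedSectionVars false

variable {E : Type*} [NormedAddCommGroup E] [InnerProductSpace ℂ E] [CompleteSpace E]
variable {S : Type*} (h : S → E →L[ℂ] E)

/-! ### Light cones -/

/-- The labels within distance `t` of a label whose term does not commute with `O`. -/
def lightCone (G : SimpleGraph S) (O : E →L[ℂ] E) (t : ℕ) : Set S :=
  {i | ∃ j, ¬ Commute O (h j) ∧ G.edist j i ≤ t}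

/-- The monoid generated by the complementary projections with labels in `Y`. -/
def projMonoid (Y : Set S) : Submonoid (E →L[ℂ] E) :=
  Submonoid.closure ((fun i => 1 - h i) '' Y)

variable {h}

theorem lightCone_mono (G : SimpleGraph S) (O : E →L[ℂ] E) {t t' : ℕ} (htt : t ≤ t') :
    lightCone h G O t ⊆ lightCone h G O t' :=
  fun _ ⟨j, hj, hji⟩ => ⟨j, hj, hji.trans (by exact_mod_cast htt)⟩

theorem commute_of_mem_projMonoid {Y : Set S} {a W : E →L[ℂ] E} (hW : W ∈ projMonoid h Y)
    (ha : ∀ i ∈ Y, Commute a (h i)) : Commute a W := by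
  refine Submonoid.closure_induction (motive := fun W _ => Commute a W) ?_ (Commute.one_right _)
    (fun _ _ _ _ => Commute.mul_right) hW
  rintro _ ⟨i, hi, rfl⟩
  exact (Commute.one_right _).sub_right (ha i hi)

/-- A product of complementary projections of one colour enlarges the light cone by one. -/
theorem exists_projProd_apply_eq {G : SimpleGraph S} {κ : Type*} (c : G.Coloring κ) {ψ : E}
    (hψ : ∀ i, h i ψ = 0) (hcomm : ∀ i j, ¬ G.Adj i j → Commute (h i) (h j)) (O : E →L[ℂ] E)
    {l : List S} {k : κ} (hl : ∀ i ∈ l, c i = k) {t : ℕ} {W : E →L[ℂ] E}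
    (hW : W ∈ projMonoid h (lightCone h G O t)) :
    ∃ W' ∈ projMonoid h (lightCone h G O (t + 1)),
      projProd h l (W (O ψ)) = W' (O ψ) := by
  suffices H : ∃ W' ∈ projMonoid h (lightCone h G O (t + 1)),
      (∀ i, c i = k → i ∉ lightCone h G O (t + 1) → Commute (h i) W') ∧
      projProd h l (W (O ψ)) = W' (O ψ) by
    obtain ⟨W', h1, -, h2⟩ := H
    exact ⟨W', h1, h2⟩
  induction l with
  | nil =>
    refine ⟨W, Submonoid.closure_mono (Set.image_mono (lightCone_mono G O (Nat.le_succ t))) hW,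
      fun i _ hi => commute_of_mem_projMonoid hW fun j hj => hcomm i j fun hij => hi ?_, by simp⟩
    obtain ⟨j', hj', hd⟩ := hj
    refine ⟨j', hj', (G.edist_triangle (v := j)).trans ?_⟩
    push_cast
    refine add_le_add hd ?_
    rw [SimpleGraph.edist_eq_one_iff_adj.2 hij.symm]
  | cons i l ih =>
    obtain ⟨W', h1, h2, h3⟩ := ih fun j hj => hl j (List.mem_cons_of_mem _ hj)
    have hik : c i = k := hl i List.mem_cons_self
    rw [projProd_cons, mul_apply_eq_comp, h3]
    by_cases hi : i ∈ lightCone h G O (t + 1)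
    · refine ⟨(1 - h i) * W', Submonoid.mul_mem _ (Submonoid.subset_closure ⟨i, hi, rfl⟩) h1,
        fun j hj hj' => ?_, rfl⟩
      refine ((Commute.one_right _).sub_right (hcomm j i fun hji => ?_)).mul_right (h2 j hj hj')
      exact c.valid hji (hj.trans hik.symm)
    · refine ⟨W', h1, h2, ?_⟩
      have hO : Commute O (h i) := by
        by_contra hO
        exact hi ⟨i, hO, by simp⟩
      have h4 : h i (W' (O ψ)) = 0 := by
        have : h i (W' (O ψ)) = (h i * (W' * O)) ψ := rfl
        rw [this, ((h2 i hik hi).mul_right hO.symm).eq, mul_apply_eq_comp, hψ, map_zero]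
      simp [h4]

theorem exists_projProd_flatten_apply_eq {G : SimpleGraph S} {κ : Type*} (c : G.Coloring κ) {ψ : E}
    (hψ : ∀ i, h i ψ = 0) (hcomm : ∀ i j, ¬ G.Adj i j → Commute (h i) (h j)) (O : E →L[ℂ] E)
    (ws : List (List S)) (hws : ∀ l ∈ ws, ∃ k, ∀ i ∈ l, c i = k) :
    ∃ W ∈ projMonoid h (lightCone h G O ws.length), projProd h ws.flatten (O ψ) = W (O ψ) := by
  induction ws with
  | nil => exact ⟨1, Submonoid.one_mem _, by simp⟩
  | cons l ws ih =>
    obtain ⟨W, hW, hW'⟩ := ih fun l hl => hws l (List.mem_cons_of_mem _ hl)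
    obtain ⟨k, hk⟩ := hws l List.mem_cons_self
    obtain ⟨W', h1, h2⟩ := exists_projProd_apply_eq c hψ hcomm O hk hW
    exact ⟨W', h1, by rw [List.flatten_cons, projProd_append, mul_apply_eq_comp, hW', h2]⟩

theorem inner_projMonoid_apply (hh : ∀ i, IsStarProjection (h i)) {Y : Set S} {χ : E}
    (hχ : ∀ i ∈ Y, h i χ = 0) {W : E →L[ℂ] E} (hW : W ∈ projMonoid h Y) (y : E) :
    ⟪χ, W y⟫_ℂ = ⟪χ, y⟫_ℂ := by
  refine Submonoid.closure_induction (motive := fun W _ => ∀ y, ⟪χ, W y⟫_ℂ = ⟪χ, y⟫_ℂ) ?_ (fun _ => rfl)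
    (fun a b _ _ ha hb y => by rw [mul_apply_eq_comp, ha, hb]) hW y
  rintro _ ⟨i, hi, rfl⟩ y
  have h1 := ContinuousLinearMap.adjoint_inner_left (h i) y χ
  rw [← ContinuousLinearMap.star_eq_adjoint, (hh i).isSelfAdjoint.star_eq, hχ i hi] at h1
  simp [← h1]

/-- The correlation with an operator outside of the light cone is not changed by a product of layers
of complementary projections. -/
theorem inner_projProd_flatten_apply (hh : ∀ i, IsStarProjection (h i)) {G : SimpleGraph S}
    {κ : Type*} (c : G.Coloring κ) {ψ : E}
    (hψ : ∀ i, h i ψ = 0) (hcomm : ∀ i j, ¬ G.Adj i j → Commute (h i) (h j)) (O O' : E →L[ℂ] E)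
    (ws : List (List S)) (hws : ∀ l ∈ ws, ∃ k, ∀ i ∈ l, c i = k)
    (hfar : ∀ i j, ¬ Commute O (h i) → ¬ Commute O' (h j) → (ws.length : ℕ∞) < G.edist i j) :
    ⟪star O ψ, projProd h ws.flatten (O' ψ)⟫_ℂ = ⟪star O ψ, O' ψ⟫_ℂ := by
  obtain ⟨W, hW, hW'⟩ := exists_projProd_flatten_apply_eq c hψ hcomm O' ws hws
  rw [hW']
  refine inner_projMonoid_apply hh (fun i hi => ?_) hW _
  obtain ⟨j, hj, hij⟩ := hi
  have hO : Commute O (h i) := by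
    by_contra hO
    have := hfar i j hO hj
    rw [SimpleGraph.edist_comm] at this
    exact absurd hij (not_le.2 this)
  have h1 : Commute (star O) (h i) := by
    have := hO.star_star
    rwa [(hh i).isSelfAdjoint.star_eq] at this
  rw [← mul_apply_eq_comp, h1.symm.eq, mul_apply_eq_comp, hψ, map_zero]

/-! ### Polynomial approximation of the projection onto the ground state -/

theorem aeval_apply_eq_of_apply_eq (T T' : E →L[ℂ] E) (K : Set E) (hK : ∀ x ∈ K, T x ∈ K)
    (hT : ∀ x ∈ K, T' x = T x) (P : Polynomial ℝ) {x : E} (hx : x ∈ K) :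
    Polynomial.aeval T' P x = Polynomial.aeval T P x := by
  have hpow : ∀ n : ℕ, (T' ^ n) x = (T ^ n) x ∧ (T ^ n) x ∈ K := by
    intro n
    induction n with
    | zero => simpa using hx
    | succ n ih =>
      rw [pow_succ', pow_succ', mul_apply_eq_comp, mul_apply_eq_comp, ih.1]
      exact ⟨hT _ ih.2, hK _ ih.2⟩
  rw [← Polynomial.aeval_map_algebraMap ℂ T', ← Polynomial.aeval_map_algebraMap ℂ T,
    Polynomial.aeval_eq_sum_range, Polynomial.aeval_eq_sum_range]
  simp [(hpow _).1]

theorem norm_aeval_star_mul_self_apply_le (D : E →L[ℂ] E) {ψ : E} (hψ : ψ ≠ 0)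
    (hD : (star D * D) ψ = ψ) {q : ℝ} (hq : 0 ≤ q)
    (hDq : ∀ x, ⟪ψ, x⟫_ℂ = 0 → ‖D x‖ ^ 2 ≤ q * ‖x‖ ^ 2) (P : Polynomial ℝ) {c : ℝ} (hc : 0 ≤ c)
    (hP : ∀ x ∈ Set.Icc 0 q, |P.eval x| ≤ c) {x : E} (hx : ⟪ψ, x⟫_ℂ = 0) :
    ‖Polynomial.aeval (star D * D) P x‖ ≤ c * ‖x‖ := by
  have : Nontrivial E := ⟨ψ, 0, hψ⟩
  set K : Submodule ℂ E := (ℂ ∙ ψ)ᗮ with hKdef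
  have hK : ∀ y, y ∈ K ↔ ⟪ψ, y⟫_ℂ = 0 := fun y => Submodule.mem_orthogonal_singleton_iff_inner_right
  set π : E →L[ℂ] E := K.starProjection with hπ
  have hTK : ∀ y ∈ (K : Set E), (star D * D) y ∈ (K : Set E) := by
    intro y hy
    rw [SetLike.mem_coe, hK] at hy ⊢
    have h1 := ContinuousLinearMap.adjoint_inner_left (star D * D) y ψ
    rw [← ContinuousLinearMap.star_eq_adjoint, star_mul, star_star, hD, hy] at h1
    exact h1.symm
  have hπs : star π = π := isStarProjection_starProjection.isSelfAdjoint.star_eq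
  have hT' : ∀ y ∈ (K : Set E), (star (D * π) * (D * π)) y = (star D * D) y := by
    intro y hy
    have h1 : π y = y := Submodule.starProjection_eq_self_iff.2 hy
    have h2 : π ((star D * D) y) = (star D * D) y := Submodule.starProjection_eq_self_iff.2 (hTK y hy)
    rw [star_mul, hπs]
    change π (star D (D (π y))) = _
    rw [h1]
    exact h2
  have hnorm : ‖star (D * π) * (D * π)‖ ≤ q := by
    rw [CStarRing.norm_star_mul_self, ← sq]
    have : ‖D * π‖ ≤ √q := by
      refine ContinuousLinearMap.opNorm_le_bound _ (Real.sqrt_nonneg _) fun y => ?_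
      refine le_of_sq_le_sq ?_ (by positivity)
      rw [mul_pow, Real.sq_sqrt hq, mul_apply_eq_comp]
      refine (hDq _ ((hK _).1 (Submodule.starProjection_apply_mem _ _))).trans ?_
      gcongr
      exact isStarProjection_starProjection.norm_apply_le y
    calc ‖D * π‖ ^ 2 ≤ √q ^ 2 := by gcongr
      _ = q := Real.sq_sqrt hq
  rw [← aeval_apply_eq_of_apply_eq _ _ (K : Set E) hTK hT' P ((hK x).2 hx)]
  refine ContinuousLinearMap.le_of_opNorm_le _ ?_ x
  have hsa : IsSelfAdjoint (star (D * π) * (D * π)) := IsSelfAdjoint.star_mul_self _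
  rw [← cfc_polynomial P _ hsa]
  refine norm_cfc_le hc fun y hy => hP y ⟨spectrum_star_mul_self_nonneg y hy, ?_⟩
  exact (le_abs_self y).trans ((spectrum.norm_le_norm_of_mem hy).trans hnorm)

/-- A Chebyshev polynomial, rescaled so that it is small on `[0, 2 / (1 + cosh θ)]`
and `1` at `1`. -/
def stepPolynomial (m : ℕ) (θ : ℝ) : Polynomial ℝ :=
  Polynomial.C (Real.cosh (m * θ))⁻¹ *
    (Polynomial.Chebyshev.T ℝ m).comp (Polynomial.C (1 + Real.cosh θ) * Polynomial.X - 1)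

theorem eval_one_stepPolynomial (m : ℕ) (θ : ℝ) : (stepPolynomial m θ).eval 1 = 1 := by
  have h1 := Polynomial.Chebyshev.T_real_cosh θ m
  simp only [stepPolynomial, Polynomial.eval_mul, Polynomial.eval_C, Polynomial.eval_comp,
    Polynomial.eval_sub, Polynomial.eval_X, Polynomial.eval_one, mul_one, add_sub_cancel_left, h1]
  exact inv_mul_cancel₀ (Real.cosh_pos _).ne'

theorem abs_eval_stepPolynomial_le (m : ℕ) (θ : ℝ) {x : ℝ}
    (hx : x ∈ Set.Icc 0 (2 / (1 + Real.cosh θ))) :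
    |(stepPolynomial m θ).eval x| ≤ (Real.cosh (m * θ))⁻¹ := by
  have hpos : 0 < 1 + Real.cosh θ := by have := Real.cosh_pos θ; linarith
  have h2 : (1 + Real.cosh θ) * x ≤ 2 := by
    have := hx.2
    rwa [le_div_iff₀ hpos, mul_comm] at this
  have h3 : 0 ≤ (1 + Real.cosh θ) * x := mul_nonneg hpos.le hx.1
  have h1 := Polynomial.Chebyshev.abs_eval_T_real_le_one m (x := (1 + Real.cosh θ) * x - 1)
    (by rw [abs_le]; constructor <;> linarith)
  simp only [stepPolynomial, Polynomial.eval_mul, Polynomial.eval_C, Polynomial.eval_comp,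
    Polynomial.eval_sub, Polynomial.eval_X, Polynomial.eval_one]
  rw [abs_mul, abs_of_pos (inv_pos.2 (Real.cosh_pos _))]
  exact mul_le_of_le_one_right (inv_pos.2 (Real.cosh_pos _)).le h1

theorem natDegree_stepPolynomial_le (m : ℕ) (θ : ℝ) : (stepPolynomial m θ).natDegree ≤ m := by
  refine (Polynomial.natDegree_C_mul_le _ _).trans (Polynomial.natDegree_comp_le.trans ?_)
  have h1 : (Polynomial.Chebyshev.T ℝ m).natDegree = m := by
    simp
  have h2 : (Polynomial.C (1 + Real.cosh θ) * Polynomial.X - 1 : Polynomial ℝ).natDegree ≤ 1 := by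
    compute_degree
  rw [h1]
  exact (Nat.mul_le_mul_left m h2).trans (mul_one m).le

/-! ### Decay of correlations -/

/-- In the ground state of a sum of projections with a gap, the correlations decay exponentially, with a
correlation length of order `γ ^ (-1 / 2)`. -/
theorem norm_correlation_le [Fintype S] (hh : ∀ i, IsStarProjection (h i)) {ψ : E} (hψ1 : ‖ψ‖ = 1)
    (hψ : ∀ i, h i ψ = 0) {G : SimpleGraph S}
    (hcomm : ∀ i j, ¬ G.Adj i j → Commute (h i) (h j)) (g : ℕ)
    (hg : ∀ i, (G.neighborSet i).ncard ≤ g) {γ : ℝ}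
    (hgap : ∀ x, ⟪ψ, x⟫_ℂ = 0 → γ * ‖x‖ ^ 2 ≤ ∑ i, ‖h i x‖ ^ 2) (O O' : E →L[ℂ] E) (m : ℕ)
    (hfar : ∀ i j, ¬ Commute O (h i) → ¬ Commute O' (h j) →
      ((2 * (g + 1) * m : ℕ) : ℕ∞) < G.edist i j)
    {θ : ℝ} (hθ : ((g : ℝ) + 1) ^ 2 * Real.sinh (θ / 2) ^ 2 ≤ γ) :
    ‖⟪ψ, O (O' ψ)⟫_ℂ - ⟪ψ, O ψ⟫_ℂ * ⟪ψ, O' ψ⟫_ℂ‖ ≤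
      (Real.cosh (m * θ))⁻¹ * (‖star O ψ‖ * ‖O' ψ‖) := by
  classical
  obtain ⟨c⟩ := G.exists_coloring_of_degree_le g hg
  set layer : Fin (g + 1) → List S := fun k => (Finset.univ.filter fun i => c i = k).toList
  have hlayer : ∀ k, ∀ i ∈ layer k, c i = k := fun k i hi => by simpa [layer] using hi
  set ws : List (List S) := (List.finRange (g + 1)).map layer with hws
  have hwsc : ∀ l ∈ ws, ∃ k, ∀ i ∈ l, c i = k := by
    intro l hl
    obtain ⟨k, -, rfl⟩ := List.mem_map.1 hl
    exact ⟨k, hlayer k⟩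
  have hmem : ∀ i, i ∈ ws.flatten := fun i =>
    List.mem_flatten.2 ⟨layer (c i), List.mem_map.2 ⟨c i, by simp, rfl⟩, by simp [layer]⟩
  have hnodup : ws.flatten.Nodup := by
    refine List.nodup_flatten.2 ⟨fun l hl => ?_, ?_⟩
    · obtain ⟨k, -, rfl⟩ := List.mem_map.1 hl
      exact Finset.nodup_toList _
    · refine List.pairwise_map.2 ((List.nodup_finRange _).imp fun {a b} hab i hia hib => hab ?_)
      rw [← hlayer a i hia, hlayer b i hib]
  set D := projProd h ws.flatten with hD
  set ws' : List (List S) := (ws.map List.reverse).reverse ++ ws with hws'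
  have hws'c : ∀ l ∈ ws', ∃ k, ∀ i ∈ l, c i = k := by
    intro l hl
    rcases List.mem_append.1 hl with hl | hl
    · obtain ⟨l', hl', rfl⟩ := List.mem_map.1 (List.mem_reverse.1 hl)
      obtain ⟨k, hk⟩ := hwsc l' hl'
      exact ⟨k, fun i hi => hk i (List.mem_reverse.1 hi)⟩
    · exact hwsc l hl
  have hT : star D * D = projProd h ws'.flatten := by
    rw [hD, star_projProd h hh, hws', List.flatten_append, projProd_append, List.reverse_flatten]
  have hpow : ∀ j : ℕ, (star D * D) ^ j = projProd h (List.replicate j ws').flatten.flatten := by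
    intro j
    induction j with
    | zero => simp
    | succ j ih =>
      rw [pow_succ', ih, hT, List.replicate_succ, List.flatten_cons,
        List.flatten_append (L₁ := ws'), projProd_append h ws'.flatten]
  have hlen : ws'.length = 2 * (g + 1) := by simp [hws', hws]; ring
  have hinner : ∀ j ≤ m, ⟪star O ψ, ((star D * D) ^ j) (O' ψ)⟫_ℂ = ⟪star O ψ, O' ψ⟫_ℂ := by
    intro j hj
    rw [hpow]
    refine inner_projProd_flatten_apply hh c hψ hcomm O O' _ ?_ fun i k hi hk => ?_
    · intro l hl
      obtain ⟨w, hw, hlw⟩ := List.mem_flatten.1 hl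
      exact hws'c l (List.eq_of_mem_replicate hw ▸ hlw)
    · refine lt_of_le_of_lt ?_ (hfar i k hi hk)
      have : (List.replicate j ws').flatten.length = 2 * (g + 1) * j := by
        simp [List.length_flatten, hlen, mul_comm]
      rw [this]
      exact_mod_cast Nat.mul_le_mul_left _ hj
  have hDψ : D ψ = ψ := projProd_apply_eq_self h hψ _
  have hTψ : (star D * D) ψ = ψ := by
    rw [hT]; exact projProd_apply_eq_self h hψ _
  have hcosh : 1 + Real.cosh θ = 2 * (1 + Real.sinh (θ / 2) ^ 2) := by
    have h1 := Real.cosh_two_mul (θ / 2)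
    have h2 := Real.cosh_sq (θ / 2)
    rw [mul_div_cancel₀ θ two_ne_zero] at h1
    rw [h1, h2]; ring
  have hDq : ∀ x, ⟪ψ, x⟫_ℂ = 0 → ‖D x‖ ^ 2 ≤ 2 / (1 + Real.cosh θ) * ‖x‖ ^ 2 := by
    intro x hx
    have hperp : ⟪ψ, D x⟫_ℂ = 0 := by
      have h1 := ContinuousLinearMap.adjoint_inner_left D x ψ
      rw [← ContinuousLinearMap.star_eq_adjoint, hD, star_projProd h hh,
        projProd_apply_eq_self h hψ, hx] at h1
      exact h1.symm
    have hg' : ∀ i, (Finset.univ.filter (fun j => ¬ Commute (h i) (h j))).card ≤ g := by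
      intro i
      refine le_trans ?_ (hg i)
      rw [← Set.ncard_coe_finset]
      refine Set.ncard_le_ncard (fun j hj => ?_) (Set.toFinite _)
      by_contra hij
      exact (Finset.mem_filter.1 (Finset.mem_coe.1 hj)).2 (hcomm i j hij)
    have h1 := (hgap _ hperp).trans
      (sum_norm_sq_projProd_le h hh x hnodup hmem g hg')
    rw [← hD] at h1
    have h2 : ‖D x‖ ^ 2 ≤ ‖x‖ ^ 2 := by
      have := (Finset.sum_nonneg fun j _ => sq_nonneg (projLoss h x ws.flatten j)).trans
        (sum_projLoss_sq_le h hh x ws.flatten)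
      linarith
    have h3 : ((g : ℝ) + 1) ^ 2 * Real.sinh (θ / 2) ^ 2 * ‖D x‖ ^ 2 ≤
        ((g : ℝ) + 1) ^ 2 * (‖x‖ ^ 2 - ‖D x‖ ^ 2) :=
      calc _ ≤ γ * ‖D x‖ ^ 2 := by gcongr
        _ ≤ (g : ℝ) ^ 2 * (‖x‖ ^ 2 - ‖D x‖ ^ 2) := h1
        _ ≤ _ := by
          have : (g : ℝ) ^ 2 ≤ ((g : ℝ) + 1) ^ 2 := by gcongr; linarith
          exact mul_le_mul_of_nonneg_right this (by linarith)
    rw [mul_assoc] at h3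
    have h4 := le_of_mul_le_mul_left h3 (by positivity)
    rw [hcosh, div_mul_eq_mul_div, le_div_iff₀ (by positivity)]
    nlinarith
  have hψ0 : ψ ≠ 0 := by rw [← norm_ne_zero_iff, hψ1]; exact one_ne_zero
  set Q := stepPolynomial m θ with hQ
  have hQψ : Polynomial.aeval (star D * D) Q ψ = ψ := by
    rw [← aeval_apply_eq_of_apply_eq (star D * D) 1 {ψ} (by simpa using hTψ) (by simpa using hTψ.symm)
      Q rfl]
    have : (1 : E →L[ℂ] E) = algebraMap ℝ _ 1 := by simp
    rw [this, Polynomial.aeval_algebraMap_apply, Polynomial.coe_aeval_eq_eval,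
      eval_one_stepPolynomial, map_one]
    rfl
  have hQO : ⟪star O ψ, Polynomial.aeval (star D * D) Q (O' ψ)⟫_ℂ = ⟪star O ψ, O' ψ⟫_ℂ := by
    have h1 : ∑ j ∈ Finset.range (Q.natDegree + 1), Q.coeff j = 1 := by
      rw [← eval_one_stepPolynomial m θ, Polynomial.eval_eq_sum_range]
      simp [hQ]
    rw [← Polynomial.aeval_map_algebraMap ℂ, Polynomial.aeval_eq_sum_range,
      Polynomial.natDegree_map]
    simp only [sum_apply, smul_apply, inner_sum,
      inner_smul_right, Polynomial.coeff_map]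
    rw [Finset.sum_congr rfl fun j hj => by
      rw [hinner j ((Nat.lt_succ_iff.1 (Finset.mem_range.1 hj)).trans
        (natDegree_stepPolynomial_le m θ))], ← Finset.sum_mul, ← map_sum, h1]
    simp
  set w := O' ψ - ⟪ψ, O' ψ⟫_ℂ • ψ with hw
  have hψψ : ⟪ψ, ψ⟫_ℂ = 1 := by rw [inner_self_eq_norm_sq_to_K, hψ1]; simp
  have hwperp : ⟪ψ, w⟫_ℂ = 0 := by
    rw [hw, inner_sub_right, inner_smul_right, hψψ]; ring
  have hwle : ‖w‖ ≤ ‖O' ψ‖ := by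
    have h1 : O' ψ = ⟪ψ, O' ψ⟫_ℂ • ψ + w := by rw [hw]; abel
    have h2 := norm_add_sq_eq_norm_sq_add_norm_sq_of_inner_eq_zero (𝕜 := ℂ)
      (⟪ψ, O' ψ⟫_ℂ • ψ) w (by rw [inner_smul_left, hwperp, mul_zero])
    rw [← h1] at h2
    exact le_of_sq_le_sq (by nlinarith [norm_nonneg (⟪ψ, O' ψ⟫_ℂ • ψ)]) (norm_nonneg _)
  have hbound := norm_aeval_star_mul_self_apply_le D hψ0 hTψ
    (by have := Real.cosh_pos θ; positivity) hDq Q (inv_pos.2 (Real.cosh_pos (m * θ))).le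
    (fun x hx => abs_eval_stepPolynomial_le m θ hx) hwperp
  have hadj : ∀ y, ⟪star O ψ, y⟫_ℂ = ⟪ψ, O y⟫_ℂ := fun y => by
    rw [ContinuousLinearMap.star_eq_adjoint, ContinuousLinearMap.adjoint_inner_left]
  have hmain : ⟪ψ, O (O' ψ)⟫_ℂ - ⟪ψ, O ψ⟫_ℂ * ⟪ψ, O' ψ⟫_ℂ =
      ⟪star O ψ, Polynomial.aeval (star D * D) Q w⟫_ℂ := by
    rw [hw, map_sub, map_smul, hQψ, inner_sub_right, inner_smul_right, hQO, hadj, hadj, mul_comm]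
  rw [hmain]
  calc _ ≤ ‖star O ψ‖ * ‖Polynomial.aeval (star D * D) Q w‖ := norm_inner_le_norm _ _
    _ ≤ ‖star O ψ‖ * ((Real.cosh (m * θ))⁻¹ * ‖O' ψ‖) := by
        gcongr
        refine hbound.trans ?_
        have := (inv_pos.2 (Real.cosh_pos (m * θ))).le
        gcongr
    _ = _ := by ring

end Correlations

/-! ### Operators on a region -/

section Region

set_option linter.unusedSectionVars false

variable {V : Type*} [Fintype V] [DecidableEq V] {d : V → ℕ} {R : Finset V}

/-- Replace a configuration inside the region `R`. -/
def patch (s : Conf d) (a : RegionConf d R) : Conf d :=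
  fun v => if h : v ∈ R then a ⟨v, h⟩ else s v

theorem patch_of_mem (s : Conf d) (a : RegionConf d R) {v : V} (hv : v ∈ R) :
    patch s a v = a ⟨v, hv⟩ := dif_pos hv

theorem patch_of_notMem (s : Conf d) (a : RegionConf d R) {v : V} (hv : v ∉ R) :
    patch s a v = s v := dif_neg hv

theorem restrict_patch (s : Conf d) (a : RegionConf d R) :
    (fun v : {v // v ∈ R} => patch s a v) = a := by
  ext v
  rw [patch_of_mem s a v.2]

@[simp] theorem patch_restrict (s : Conf d) :
    patch s (fun v : {v // v ∈ R} => s v) = s := by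
  ext v
  by_cases hv : v ∈ R <;> simp [patch, hv]

@[simp] theorem patch_patch (s : Conf d) (a b : RegionConf d R) :
    patch (patch s a) b = patch s b := by
  ext v
  by_cases hv : v ∈ R <;> simp [patch, hv]

theorem extendOp_mulVec (M : Matrix (RegionConf d R) (RegionConf d R) ℂ) (φ : Conf d → ℂ)
    (s : Conf d) :
    (extendOp R M *ᵥ φ) s = ∑ a, M (fun v => s v) a * φ (patch s a) := by
  classical
  have h1 : (extendOp R M *ᵥ φ) s = ∑ t ∈ Finset.univ.filter (fun t => ∀ v, v ∉ R → s v = t v),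
      M (fun v => s v) (fun v => t v) * φ t := by
    rw [Finset.sum_filter]
    refine Finset.sum_congr rfl fun t _ => ?_
    simp only [extendOp]
    split_ifs <;> simp
  rw [h1]
  refine Finset.sum_nbij' (fun t v => t v) (fun a => patch s a) (by simp) ?_ ?_ ?_ ?_
  · intro a _
    simp only [Finset.mem_filter, Finset.mem_univ, true_and]
    intro v hv
    rw [patch_of_notMem s a hv]
  · intro t ht
    ext v
    by_cases hv : v ∈ R
    · simp [patch, hv]
    · simp [patch, hv, (Finset.mem_filter.1 ht).2 v hv]
  · intro a _
    exact restrict_patch s a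
  · intro t ht
    congr 2
    ext v
    by_cases hv : v ∈ R
    · simp [patch, hv]
    · simp [patch, hv, (Finset.mem_filter.1 ht).2 v hv]

theorem extendOp_mul (M N : Matrix (RegionConf d R) (RegionConf d R) ℂ) :
    extendOp R (M * N) = extendOp R M * extendOp R N := by
  refine Matrix.ext_of_mulVec_single fun t => ?_
  funext s
  rw [← Matrix.mulVec_mulVec, extendOp_mulVec, extendOp_mulVec]
  simp only [extendOp_mulVec, restrict_patch, patch_patch, Matrix.mul_apply, Finset.sum_mul,
    Finset.mul_sum, mul_assoc]
  exact Finset.sum_comm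

theorem extendOp_conjTranspose (M : Matrix (RegionConf d R) (RegionConf d R) ℂ) :
    (extendOp R M)ᴴ = extendOp R Mᴴ := by
  ext s t
  simp only [Matrix.conjTranspose_apply, extendOp, apply_ite star, star_zero]
  congr 1
  exact propext ⟨fun H v hv => (H v hv).symm, fun H v hv => (H v hv).symm⟩

theorem IsStarProjection.extendOp {M : Matrix (RegionConf d R) (RegionConf d R) ℂ}
    (hM : IsStarProjection M) : IsStarProjection (extendOp R M) where
  isIdempotentElem := by
    rw [IsIdempotentElem, ← extendOp_mul, hM.isIdempotentElem.eq]
  isSelfAdjoint := by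
    rw [IsSelfAdjoint, Matrix.star_eq_conjTranspose, extendOp_conjTranspose,
      ← Matrix.star_eq_conjTranspose, hM.isSelfAdjoint.star_eq]

theorem isStarProjection_localProjector (ψ : StateSpace d) (R : Finset V) :
    IsStarProjection (localProjector ψ R) := by
  have h1 : IsStarProjection (opSupport (reducedDensity ψ R))ᗮ.starProjection :=
    isStarProjection_starProjection
  refine ⟨?_, ?_⟩
  · rw [IsIdempotentElem, localProjector, ← map_mul, h1.isIdempotentElem.eq]
  · apply (Matrix.toEuclideanCLM (n := RegionConf d R) (𝕜 := ℂ)).injective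
    change toOp (star (localProjector ψ R)) = toOp (localProjector ψ R)
    rw [toOp, toOp, map_star, localProjector, StarAlgEquiv.apply_symm_apply, h1.isSelfAdjoint.star_eq]

theorem isStarProjection_parentTerm {S : Type*} (ψ : StateSpace d) (R : S → Finset V) (i : S) :
    IsStarProjection (parentTerm ψ R i) :=
  (isStarProjection_localProjector ψ (R i)).extendOp

/-- The vectors on `R` obtained from `ψ` by fixing the configuration outside `R` span the support
of the reduced density matrix. -/
theorem opSupport_reducedDensity (ψ : StateSpace d) (R : Finset V) :
    opSupport (reducedDensity ψ R) = Submodule.span ℂ (Set.range fun c : OutsideConf d R =>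
      (WithLp.toLp 2 fun a => ψ (glue a c) : EuclideanSpace ℂ (RegionConf d R))) := by
  set w : OutsideConf d R → EuclideanSpace ℂ (RegionConf d R) :=
    fun c => WithLp.toLp 2 fun a => ψ (glue a c) with hw
  have hρ : ∀ x, toOp (reducedDensity ψ R) x = ∑ c, ⟪w c, x⟫_ℂ • w c := by
    intro x
    ext a
    simp only [hw, Matrix.ofLp_toEuclideanCLM, Matrix.mulVec, dotProduct, reducedDensity,
      WithLp.ofLp_sum, Finset.sum_apply, WithLp.ofLp_smul, Pi.smul_apply, smul_eq_mul,
      PiLp.inner_apply, Finset.sum_mul, RCLike.inner_apply]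
    rw [Finset.sum_comm]
    refine Finset.sum_congr rfl fun c _ => Finset.sum_congr rfl fun b _ => ?_
    simp only [RCLike.star_def]
    ring
  have hker : LinearMap.ker (toOp (reducedDensity ψ R)).toLinearMap =
      (Submodule.span ℂ (Set.range w))ᗮ := by
    ext x
    rw [LinearMap.mem_ker, Submodule.mem_orthogonal]
    change toOp (reducedDensity ψ R) x = 0 ↔ _
    constructor
    · intro hx
      have h1 : ∑ c, (‖⟪w c, x⟫_ℂ‖ ^ 2 : ℝ) = 0 := by
        have h2 : ⟪x, toOp (reducedDensity ψ R) x⟫_ℂ = ((∑ c, ‖⟪w c, x⟫_ℂ‖ ^ 2 : ℝ) : ℂ) := by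
          rw [hρ, inner_sum]
          push_cast
          refine Finset.sum_congr rfl fun c _ => ?_
          rw [inner_smul_right, ← inner_conj_symm x (w c), RCLike.mul_conj]
          rfl
        rw [hx, inner_zero_right] at h2
        exact_mod_cast h2.symm
      have h3 : ∀ c, ⟪w c, x⟫_ℂ = 0 := fun c => by
        have := (Finset.sum_eq_zero_iff_of_nonneg fun c _ => sq_nonneg _).1 h1 c (Finset.mem_univ _)
        simpa using this
      intro u hu
      induction hu using Submodule.span_induction with
      | mem u hu => obtain ⟨c, rfl⟩ := hu; exact h3 c
      | zero => simp
      | add u v _ _ hu hv => rw [inner_add_left, hu, hv, add_zero]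
      | smul r u _ hu => rw [inner_smul_left, hu, mul_zero]
    · intro hx
      rw [hρ]
      exact Finset.sum_eq_zero fun c _ => by
        rw [hx _ (Submodule.subset_span ⟨c, rfl⟩), zero_smul]
  rw [opSupport, hker, Submodule.orthogonal_orthogonal]

theorem toOp_parentTerm_apply_eq_zero_iff {S : Type*} (ψ φ : StateSpace d) (R : S → Finset V)
    (i : S) : toOp (parentTerm ψ R i) φ = 0 ↔ ∀ s : Conf d,
      (WithLp.toLp 2 fun a => φ (patch s a) : EuclideanSpace ℂ (RegionConf d (R i))) ∈
        opSupport (reducedDensity ψ (R i)) := by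
  have h1 : ∀ x : EuclideanSpace ℂ (RegionConf d (R i)),
      x ∈ opSupport (reducedDensity ψ (R i)) ↔ localProjector ψ (R i) *ᵥ x.ofLp = 0 := by
    intro x
    rw [← Matrix.ofLp_toEuclideanCLM, localProjector, StarAlgEquiv.apply_symm_apply,
      WithLp.ofLp_eq_zero, Submodule.starProjection_apply_eq_zero_iff,
      Submodule.orthogonal_orthogonal]
  have h2 : toOp (parentTerm ψ R i) φ = 0 ↔ parentTerm ψ R i *ᵥ φ.ofLp = 0 := by
    rw [← Matrix.ofLp_toEuclideanCLM]
    exact (WithLp.ofLp_eq_zero 2).symm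
  rw [h2]
  simp only [h1, funext_iff]
  have h3 : ∀ s, (parentTerm ψ R i *ᵥ φ.ofLp) s =
      (localProjector ψ (R i) *ᵥ fun a => φ (patch s a)) (fun v => s v) := fun s =>
    extendOp_mulVec _ _ s
  constructor
  · intro H s a
    have := H (patch s a)
    rw [h3, restrict_patch] at this
    simpa using this
  · intro H s
    rw [h3]
    exact H s _

theorem toOp_parentTerm_apply_self {S : Type*} (ψ : StateSpace d) (R : S → Finset V)
    (i : S) : toOp (parentTerm ψ R i) ψ = 0 := by
  rw [toOp_parentTerm_apply_eq_zero_iff]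
  intro s
  rw [opSupport_reducedDensity]
  exact Submodule.subset_span ⟨fun v => s v, rfl⟩

end Region

/-! ### Sums of projections -/

section Sum

set_option linter.unusedSectionVars false

open scoped ComplexOrder

variable {ι : Type*} [Fintype ι] [DecidableEq ι]

theorem IsStarProjection.toOp {M : Matrix ι ι ℂ} (hM : IsStarProjection M) :
    IsStarProjection (toOp M) where
  isIdempotentElem := by rw [IsIdempotentElem, ← map_mul, hM.isIdempotentElem.eq]
  isSelfAdjoint := by rw [IsSelfAdjoint, ← map_star, hM.isSelfAdjoint.star_eq]

theorem commute_toOp_iff {M N : Matrix ι ι ℂ} : Commute (toOp M) (toOp N) ↔ Commute M N := by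
  rw [commute_iff_eq, commute_iff_eq, ← map_mul, ← map_mul]
  exact (Matrix.toEuclideanCLM (n := ι) (𝕜 := ℂ)).injective.eq_iff

variable {S : Type*} [Fintype S] {H : S → Matrix ι ι ℂ}

theorem toOp_hamiltonian_apply (x : EuclideanSpace ℂ ι) :
    toOp (hamiltonian H) x = ∑ i, toOp (H i) x := by
  rw [hamiltonian, toOp, map_sum, sum_apply]

theorem inner_toOp_hamiltonian (hH : ∀ i, IsStarProjection (H i)) (x : EuclideanSpace ℂ ι) :
    ⟪x, toOp (hamiltonian H) x⟫_ℂ = ((∑ i, ‖toOp (H i) x‖ ^ 2 : ℝ) : ℂ) := by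
  rw [toOp_hamiltonian_apply, inner_sum, Complex.ofReal_sum]
  exact Finset.sum_congr rfl fun i _ => (hH i).toOp.inner_apply_self x

theorem toOp_hamiltonian_apply_eq_zero_iff (hH : ∀ i, IsStarProjection (H i))
    (x : EuclideanSpace ℂ ι) : toOp (hamiltonian H) x = 0 ↔ ∀ i, toOp (H i) x = 0 := by
  constructor
  · intro hx i
    have h1 := inner_toOp_hamiltonian hH x
    rw [hx, inner_zero_right] at h1
    have h2 := (Finset.sum_eq_zero_iff_of_nonneg fun i _ => sq_nonneg _).1
      (Complex.ofReal_eq_zero.1 h1.symm) i (Finset.mem_univ i)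
    simpa using h2
  · intro hx
    rw [toOp_hamiltonian_apply]
    exact Finset.sum_eq_zero fun i _ => hx i

theorem posSemidef_hamiltonian (hH : ∀ i, IsStarProjection (H i)) : (hamiltonian H).PosSemidef := by
  refine Matrix.posSemidef_sum _ fun i _ => ?_
  have := Matrix.posSemidef_conjTranspose_mul_self (H i)
  rwa [← Matrix.star_eq_conjTranspose, (hH i).isSelfAdjoint.star_eq,
    (hH i).isIdempotentElem.eq] at this

theorem nonneg_of_hasEigenvalue {M : Matrix ι ι ℂ} (hM : M.PosSemidef) {lam : ℝ}
    (h : Module.End.HasEigenvalue (Matrix.toLin' M) (lam : ℂ)) : 0 ≤ lam := by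
  obtain ⟨v, hv⟩ := h.exists_hasEigenvector
  have h1 := hv.apply_eq_smul
  rw [Matrix.toLin'_apply] at h1
  have h2 := hM.dotProduct_mulVec_nonneg v
  rw [h1, dotProduct_smul, smul_eq_mul] at h2
  have h3 : 0 < star v ⬝ᵥ v := Matrix.dotProduct_star_self_pos_iff.2 hv.2
  have h4 := (Complex.le_def.1 h2).1
  rw [Complex.re_ofReal_mul] at h4
  exact nonneg_of_mul_nonneg_left h4 (Complex.lt_def.1 h3).1

theorem bddBelow_nonzero_eigenvalues {M : Matrix ι ι ℂ} (hM : M.PosSemidef) : BddBelow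
    {lam : ℝ | lam ≠ 0 ∧ Module.End.HasEigenvalue (Matrix.toLin' M) (lam : ℂ)} :=
  ⟨0, fun _ h => nonneg_of_hasEigenvalue hM h.2⟩

theorem hasEigenvalue_eigenvalues {M : Matrix ι ι ℂ} (hM : M.IsHermitian) (j : ι) :
    Module.End.HasEigenvalue (Matrix.toLin' M) (hM.eigenvalues j : ℂ) := by
  refine Module.End.hasEigenvalue_of_hasEigenvector (x := (hM.eigenvectorBasis j).ofLp)
    ⟨Module.End.mem_eigenspace_iff.2 ?_, ?_⟩
  · rw [Matrix.toLin'_apply, hM.mulVec_eigenvectorBasis]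
    rfl
  · rw [Ne, WithLp.ofLp_eq_zero]
    exact hM.eigenvectorBasis.orthonormal.ne_zero j

theorem spectralGap_mul_norm_sq_le {M : Matrix ι ι ℂ} (hM : M.PosSemidef)
    {x : EuclideanSpace ℂ ι} (hx : ∀ y, toOp M y = 0 → ⟪y, x⟫_ℂ = 0) :
    spectralGap M * ‖x‖ ^ 2 ≤ (⟪x, toOp M x⟫_ℂ).re := by
  set b := hM.isHermitian.eigenvectorBasis
  set ev := hM.isHermitian.eigenvalues
  have hb : ∀ j, toOp M (b j) = (ev j : ℂ) • b j := by
    intro j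
    apply WithLp.ofLp_injective
    rw [Matrix.ofLp_toEuclideanCLM, hM.isHermitian.mulVec_eigenvectorBasis]
    rfl
  have hsa : ∀ y z, ⟪y, toOp M z⟫_ℂ = ⟪toOp M y, z⟫_ℂ := by
    intro y z
    rw [← ContinuousLinearMap.adjoint_inner_left, ← ContinuousLinearMap.star_eq_adjoint, ← map_star,
      Matrix.star_eq_conjTranspose, hM.isHermitian.eq]
  have h1 : (⟪x, toOp M x⟫_ℂ).re = ∑ j, ev j * ‖⟪b j, x⟫_ℂ‖ ^ 2 := by
    rw [← b.sum_inner_mul_inner x (toOp M x), Complex.re_sum]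
    refine Finset.sum_congr rfl fun j _ => ?_
    rw [hsa, hb, inner_smul_left, Complex.conj_ofReal, mul_left_comm, ← inner_conj_symm x (b j),
      mul_comm (starRingEnd ℂ _), RCLike.mul_conj]
    norm_cast
    exact Complex.re_ofReal_mul _ _
  rw [h1, ← b.sum_sq_norm_inner_right x, Finset.mul_sum]
  refine Finset.sum_le_sum fun j _ => ?_
  by_cases hj : ev j = 0
  · rw [hx (b j) (by rw [hb, hj]; simp)]
    simp
  · gcongr
    exact csInf_le (bddBelow_nonzero_eigenvalues hM) ⟨hj, hasEigenvalue_eigenvalues hM.isHermitian j⟩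

theorem spectralGap_pos {M : Matrix ι ι ℂ} (hM : M.PosSemidef) (h0 : M ≠ 0) :
    0 < spectralGap M := by
  have hne : {lam : ℝ | lam ≠ 0 ∧
      Module.End.HasEigenvalue (Matrix.toLin' M) (lam : ℂ)}.Nonempty := by
    by_contra hcon
    rw [Set.not_nonempty_iff_eq_empty] at hcon
    apply h0
    rw [← hM.isHermitian.eigenvalues_eq_zero_iff]
    funext j
    by_contra hj
    have : hM.isHermitian.eigenvalues j ∈ (∅ : Set ℝ) :=
      hcon ▸ ⟨hj, hasEigenvalue_eigenvalues hM.isHermitian j⟩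
    exact this
  have hfin : {lam : ℝ | lam ≠ 0 ∧
      Module.End.HasEigenvalue (Matrix.toLin' M) (lam : ℂ)}.Finite := by
    refine Set.Finite.subset (Set.Finite.preimage (Complex.ofReal_injective.injOn)
      (Module.End.finite_hasEigenvalue (Matrix.toLin' M))) fun lam h => h.2
  have hmem := hne.csInf_mem hfin
  exact lt_of_le_of_ne (nonneg_of_hasEigenvalue hM hmem.2) (Ne.symm hmem.1)

end Sum

/-- A function on a finite product that does not change when one coordinate is replaced is
constant. -/
theorem eq_of_forall_update_eq {ι X : Type*} [Fintype ι] [DecidableEq ι] {π : ι → Type*}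
    (f : (∀ i, π i) → X) (hf : ∀ s i x, f (Function.update s i x) = f s) (s s' : ∀ i, π i) :
    f s = f s' := by
  have key : ∀ T : Finset ι, f (T.piecewise s' s) = f s := by
    intro T
    induction T using Finset.induction_on with
    | empty => simp
    | insert j T _ ih => rw [Finset.piecewise_insert, hf, ih]
  simpa using (key Finset.univ).symm

namespace PEPS

section Contraction

set_option linter.unusedSectionVars false

variable {V : Type*} [Fintype V] [DecidableEq V] {G : SimpleGraph V} [DecidableRel G.Adj]
  (Λ : PEPS G)

/-- Assignments of virtual indices to all edges. -/
abbrev VirtualConf : Type _ := ∀ e : G.edgeSet, Fin (Λ.bondDim e)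

/-- Assignments of virtual indices to the boundary edges of a region. -/
abbrev BoundaryConf (B : Finset V) : Type _ := ∀ e : BoundaryEdge G B, Fin (Λ.bondDim e.1.1)

/-- The edge `e` has an end in `B`. -/
abbrev Touches (B : Finset V) (e : G.edgeSet) : Prop := ∃ v ∈ B, v ∈ e.1

/-- The product of the tensors at the vertices in `U`. -/
def weight (U : Finset V) (s : Conf Λ.physDim) (σ : Λ.VirtualConf) : ℂ :=
  ∏ v ∈ U, Λ.tensor v (s v) (fun e => σ e.1)

variable {Λ}

/-- `F` does not depend on the virtual indices of the edges with both ends in `U`. -/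
def InnerIndep (U : Finset V) (F : Λ.VirtualConf → ℂ) : Prop :=
  ∀ σ τ, (∀ e : G.edgeSet, (∃ v, v ∉ U ∧ v ∈ e.1) → σ e = τ e) → F σ = F τ

/-- On the region `U`, the vector `φ` is a contraction of the tensors in `U` with some
tensor that does not involve the edges inside `U`. -/
def IsContraction (U : Finset V) (φ : Conf Λ.physDim → ℂ) : Prop :=
  ∀ s, ∃ C : Λ.VirtualConf → ℂ, InnerIndep U C ∧
    ∀ a : RegionConf Λ.physDim U, φ (patch s a) = ∑ σ, C σ * Λ.weight U (patch s a) σ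

theorem InnerIndep.mono {U U' : Finset V} (hU : U ⊆ U') {F : Λ.VirtualConf → ℂ}
    (hF : InnerIndep U' F) : InnerIndep U F :=
  fun σ σ' h => hF σ σ' fun e ⟨v, hv, hve⟩ => h e ⟨v, fun hvU => hv (hU hvU), hve⟩

theorem InnerIndep.mul {U : Finset V} {F F' : Λ.VirtualConf → ℂ}
    (hF : InnerIndep U F) (hF' : InnerIndep U F') : InnerIndep U fun σ => F σ * F' σ :=
  fun σ σ' h => by simp only [hF σ σ' h, hF' σ σ' h]

theorem innerIndep_weight {U W : Finset V} (hUW : Disjoint W U) (s : Conf Λ.physDim) :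
    InnerIndep U (Λ.weight W s) := by
  intro σ σ' h
  refine Finset.prod_congr rfl fun v hv => ?_
  congr 1
  funext e
  exact h e.1 ⟨v, Finset.disjoint_left.1 hUW hv, e.2⟩

theorem innerIndep_ite {U W : Finset V} (hUW : Disjoint W U) (β : Λ.VirtualConf)
    {F : Λ.VirtualConf → ℂ} (hF : InnerIndep U F) :
    InnerIndep U fun σ => if ∀ e, Touches W e → σ e = β e then F σ else 0 := by
  intro σ σ' h
  have h1 : (∀ e, Touches W e → σ e = β e) ↔ ∀ e, Touches W e → σ' e = β e := by
    refine forall_congr' fun e => imp_congr_right fun ⟨v, hv, hve⟩ => ?_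
    rw [h e ⟨v, Finset.disjoint_left.1 hUW hv, hve⟩]
  simp only [h1, hF σ σ' h]

theorem weight_congr {U : Finset V} {s s' : Conf Λ.physDim} (h : ∀ v ∈ U, s v = s' v)
    (σ : Λ.VirtualConf) : Λ.weight U s σ = Λ.weight U s' σ :=
  Finset.prod_congr rfl fun v hv => by rw [h v hv]

theorem weight_sdiff_mul {U W : Finset V} (hUW : U ⊆ W) (s : Conf Λ.physDim)
    (σ : Λ.VirtualConf) : Λ.weight (W \ U) s σ * Λ.weight U s σ = Λ.weight W s σ :=
  Finset.prod_sdiff hUW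

theorem IsContraction.mono {U W : Finset V} (hUW : U ⊆ W) {φ : Conf Λ.physDim → ℂ}
    (hφ : IsContraction W φ) : IsContraction U φ := by
  intro s
  obtain ⟨C, hC, hCφ⟩ := hφ s
  refine ⟨fun σ => C σ * Λ.weight (W \ U) s σ,
    (hC.mono hUW).mul (innerIndep_weight Finset.sdiff_disjoint s), fun a => ?_⟩
  have h1 : patch s a = patch s (fun v : {v // v ∈ W} => patch s a v) := by
    ext v
    by_cases hv : v ∈ W
    · rw [patch_of_mem (R := W) _ _ hv]
    · rw [patch_of_notMem (R := W) _ _ hv, patch_of_notMem _ _ fun hvU => hv (hUW hvU)]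
  have h2 := hCφ (fun v => patch s a v)
  rw [← h1] at h2
  rw [h2]
  refine Finset.sum_congr rfl fun σ _ => ?_
  rw [← weight_sdiff_mul hUW, mul_assoc,
    weight_congr (s := patch s a) (s' := s) (U := W \ U) fun v hv =>
      patch_of_notMem _ _ (Finset.mem_sdiff.1 hv).2]

theorem IsContraction.sub_smul {U : Finset V} {φ φ' : Conf Λ.physDim → ℂ}
    (hφ : IsContraction U φ) (hφ' : IsContraction U φ') (r : ℂ) :
    IsContraction U (φ - r • φ') := by
  intro s
  obtain ⟨C, hC, hCφ⟩ := hφ s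
  obtain ⟨C', hC', hCφ'⟩ := hφ' s
  refine ⟨fun σ => C σ - r * C' σ, fun σ σ' h => by simp only [hC σ σ' h, hC' σ σ' h], fun a => ?_⟩
  simp only [Pi.sub_apply, Pi.smul_apply, smul_eq_mul, hCφ, hCφ', sub_mul, Finset.sum_sub_distrib,
    Finset.mul_sum, mul_assoc]

theorem state_apply (s : Conf Λ.physDim) : Λ.state s = ∑ σ, Λ.weight Finset.univ s σ := rfl

theorem isContraction_state (U : Finset V) : IsContraction U (Λ.state : Conf Λ.physDim → ℂ) := by
  refine IsContraction.mono (Finset.subset_univ U) fun s => ⟨fun _ => 1, fun _ _ _ => rfl, fun a => ?_⟩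
  simp [state_apply]

theorem isContraction_of_parentTerm {S : Type*} (R : S → Finset V) (i : S)
    {φ : StateSpace Λ.physDim} (hφ : toOp (Λ.term R i) φ = 0) :
    IsContraction (R i) (φ : Conf Λ.physDim → ℂ) := by
  intro s
  have h1 := (toOp_parentTerm_apply_eq_zero_iff Λ.state φ R i).1 hφ s
  rw [opSupport_reducedDensity] at h1
  suffices H : ∀ x : EuclideanSpace ℂ (RegionConf Λ.physDim (R i)),
      x ∈ Submodule.span ℂ (Set.range fun c : OutsideConf Λ.physDim (R i) =>
        (WithLp.toLp 2 fun a => Λ.state (glue a c) :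
          EuclideanSpace ℂ (RegionConf Λ.physDim (R i)))) →
      ∃ C : Λ.VirtualConf → ℂ, InnerIndep (R i) C ∧
        ∀ a, x a = ∑ σ, C σ * Λ.weight (R i) (patch s a) σ by
    exact H _ h1
  intro x hx
  induction hx using Submodule.span_induction with
  | mem x hx =>
    obtain ⟨c, rfl⟩ := hx
    obtain ⟨C, hC, hCφ⟩ := isContraction_state (Λ := Λ) (R i) (glue (fun v => s v) c)
    refine ⟨C, hC, fun a => ?_⟩
    have h2 : ∀ a, glue a c = patch (glue (fun v => s v) c) a := by
      intro a
      ext v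
      by_cases hv : v ∈ R i <;> simp [patch, glue, hv]
    have h3 := hCφ a
    rw [← h2] at h3
    change Λ.state (glue a c) = _
    rw [h3]
    refine Finset.sum_congr rfl fun σ _ => ?_
    rw [weight_congr fun v hv => ?_]
    rw [h2, patch_of_mem _ _ hv, patch_of_mem _ _ hv]
  | zero => exact ⟨fun _ => 0, fun _ _ _ => rfl, by simp⟩
  | add x y _ _ hx hy =>
    obtain ⟨C, hC, hCx⟩ := hx
    obtain ⟨C', hC', hCy⟩ := hy
    refine ⟨fun σ => C σ + C' σ, fun σ σ' h => by simp only [hC σ σ' h, hC' σ σ' h], fun a => ?_⟩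
    simp [hCx, hCy, add_mul, Finset.sum_add_distrib]
  | smul r x _ hx =>
    obtain ⟨C, hC, hCx⟩ := hx
    refine ⟨fun σ => r * C σ, fun σ σ' h => by simp only [hC σ σ' h], fun a => ?_⟩
    simp [hCx, mul_assoc, Finset.mul_sum]

/-- A contraction over all virtual indices, as the image of a boundary tensor. -/
theorem exists_boundary_tensor (B : Finset V) {F : Λ.VirtualConf → ℂ} (hF : InnerIndep B F) :
    ∃ C : Λ.BoundaryConf B → ℂ,
      (∀ s : Conf Λ.physDim, ∀ a : RegionConf Λ.physDim B,
        ∑ σ, F σ * Λ.weight B (patch s a) σ = Λ.regionMap B C a) ∧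
      ∀ β : Λ.VirtualConf, C (fun e => β e.1.1) =
        ∑ σ, if ∀ e, Touches B e → σ e = β e then F σ else 0 := by
  classical
  set J := (Equiv.piEquivPiSubtypeProd (fun e : G.edgeSet => Touches B e)
    (fun e => Fin (Λ.bondDim e))).symm with hJ
  have hJt : ∀ p e (he : Touches B e), J p e = p.1 ⟨e, he⟩ := fun p e he => by
    simp [hJ, Equiv.piEquivPiSubtypeProd, he]
  have hJn : ∀ p e (he : ¬ Touches B e), J p e = p.2 ⟨e, he⟩ := fun p e he => by
    simp only [hJ, Equiv.piEquivPiSubtypeProd, Equiv.coe_fn_symm_mk]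
    rw [dif_neg he]
  set ext : Λ.BoundaryConf B → (∀ e : {e : G.edgeSet // Touches B e}, Fin (Λ.bondDim e)) :=
    fun ρ e => if h : ∃ v, v ∉ B ∧ v ∈ e.1.1 then ρ ⟨e, h⟩ else ⟨0, Λ.bondDim_pos e⟩ with hext
  have hFext : ∀ τ b, F (J (ext (fun e => τ e.1), b)) = F (J (τ, b)) := by
    intro τ b
    refine hF _ _ fun e he => ?_
    by_cases het : Touches B e
    · rw [hJt _ _ het, hJt _ _ het]
      simp only [hext]
      rw [dif_pos he]
    · rw [hJn _ _ het, hJn _ _ het]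
  refine ⟨fun ρ => ∑ b, F (J (ext ρ, b)), fun s a => ?_, fun β => ?_⟩
  · rw [← J.sum_comp, Fintype.sum_prod_type, regionMap]
    refine Fintype.sum_congr _ _ fun τ => ?_
    rw [Finset.sum_mul]
    refine Finset.sum_congr rfl fun b _ => ?_
    rw [hFext]
    congr 1
    rw [weight, ← Finset.prod_coe_sort]
    refine Finset.prod_congr rfl fun v _ => ?_
    rw [patch_of_mem _ _ v.2]
    congr 1
    funext e
    rw [hJt _ _ ⟨v, v.2, e.2⟩]
  · rw [← J.sum_comp, Fintype.sum_prod_type,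
      Fintype.sum_eq_single (fun e : {e : G.edgeSet // Touches B e} => β e.1)]
    · refine Finset.sum_congr rfl fun b _ => ?_
      rw [if_pos fun e he => hJt _ e he]
      exact hFext (fun e => β e.1) b
    · intro τ hτ
      refine Finset.sum_eq_zero fun b _ => if_neg fun H => hτ ?_
      funext e
      rw [← H e.1 e.2, hJt _ _ e.2]

/-! ### Reading out the boundary indices of an injective block -/

variable (Λ) in
/-- `Γ_B` as a linear map. -/
def regionMapLinear (B : Finset V) :
    (Λ.BoundaryConf B → ℂ) →ₗ[ℂ] (RegionConf Λ.physDim B → ℂ) where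
  toFun := Λ.regionMap B
  map_add' C C' := by
    funext a
    simp [regionMap, add_mul, Finset.sum_add_distrib]
  map_smul' r C := by
    funext a
    simp [regionMap, mul_assoc, Finset.mul_sum]

variable (Λ) in
/-- The tensor that reads out the boundary indices `β` of the block `B`, through a left inverse
of `Γ_B`. -/
def dualTensor (B : Finset V) (β : Λ.VirtualConf) (a : RegionConf Λ.physDim B) : ℂ :=
  (Λ.regionMapLinear B).leftInverse (Pi.single a 1) (fun e => β e.1.1)

theorem sum_dualTensor_mul_regionMap {B : Finset V} (hB : Λ.InjectiveRegion B)
    (C : Λ.BoundaryConf B → ℂ) (β : Λ.VirtualConf) :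
    ∑ a, Λ.dualTensor B β a * Λ.regionMap B C a = C (fun e => β e.1.1) := by
  have hker : LinearMap.ker (Λ.regionMapLinear B) = ⊥ := LinearMap.ker_eq_bot.2 hB
  have h1 := LinearMap.leftInverse_apply_of_inj hker C
  have h2 : Λ.regionMapLinear B C = ∑ a, Λ.regionMap B C a • Pi.single a (1 : ℂ) := by
    funext b
    simp [Finset.sum_apply, Pi.single_apply, regionMapLinear]
  rw [h2, map_sum] at h1
  have h3 := congrFun h1 (fun e => β e.1.1)
  rw [← h3, Finset.sum_apply]
  refine Finset.sum_congr rfl fun a _ => ?_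
  rw [map_smul, Pi.smul_apply, smul_eq_mul, mul_comm, dualTensor]

theorem dualTensor_congr {B : Finset V} {β β' : Λ.VirtualConf}
    (h : ∀ e, Touches B e → (∃ v, v ∉ B ∧ v ∈ e.1) → β e = β' e) :
    Λ.dualTensor B β = Λ.dualTensor B β' := by
  funext a
  have h1 : (fun e : BoundaryEdge G B => β e.1.1) =
      fun e : BoundaryEdge G B => β' e.1.1 :=
    funext fun e => h _ e.1.2 e.2
  rw [dualTensor, dualTensor, h1]

variable (Λ) in
/-- Contract the block `B` with the tensor that reads out its boundary indices `β`. -/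
def readOp (B : Finset V) (β : Λ.VirtualConf) : Module.End ℂ (Conf Λ.physDim → ℂ) where
  toFun φ s := ∑ a, Λ.dualTensor B β a * φ (patch s a)
  map_add' φ φ' := by
    funext s
    simp [mul_add, Finset.sum_add_distrib]
  map_smul' r φ := by
    funext s
    simp [mul_left_comm, Finset.mul_sum]

theorem readOp_apply (B : Finset V) (β : Λ.VirtualConf) (φ : Conf Λ.physDim → ℂ)
    (s : Conf Λ.physDim) :
    Λ.readOp B β φ s = ∑ a, Λ.dualTensor B β a * φ (patch s a) := rfl

theorem readOp_congr {B : Finset V} {β β' : Λ.VirtualConf}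
    (h : ∀ e, Touches B e → (∃ v, v ∉ B ∧ v ∈ e.1) → β e = β' e) :
    Λ.readOp B β = Λ.readOp B β' := by
  refine LinearMap.ext fun φ => funext fun s => ?_
  rw [readOp_apply, readOp_apply, dualTensor_congr h]

theorem patch_comm {d : V → ℕ} {B B' : Finset V} (hB : Disjoint B B') (s : Conf d)
    (a : RegionConf d B) (a' : RegionConf d B') : patch (patch s a) a' = patch (patch s a') a := by
  funext v
  have hd : v ∈ B → v ∉ B' := fun h => Finset.disjoint_left.1 hB h
  by_cases hv : v ∈ B <;> by_cases hv' : v ∈ B' <;> simp_all [patch]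

theorem commute_readOp {B B' : Finset V} (hB : Disjoint B B') (β β' : Λ.VirtualConf) :
    Commute (Λ.readOp B β) (Λ.readOp B' β') := by
  refine LinearMap.ext fun φ => funext fun s => ?_
  simp only [Module.End.mul_apply, readOp_apply, Finset.mul_sum]
  rw [Finset.sum_comm]
  refine Finset.sum_congr rfl fun a _ => Finset.sum_congr rfl fun b _ => ?_
  rw [patch_comm hB, mul_left_comm]

theorem readOp_eq_of_contraction {B : Finset V} (hB : Λ.InjectiveRegion B) (β : Λ.VirtualConf)
    {φ : Conf Λ.physDim → ℂ} {s : Conf Λ.physDim} {F : Λ.VirtualConf → ℂ} (hF : InnerIndep B F)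
    (hφ : ∀ a : RegionConf Λ.physDim B, φ (patch s a) = ∑ σ, F σ * Λ.weight B (patch s a) σ) :
    Λ.readOp B β φ s = ∑ σ, if ∀ e, Touches B e → σ e = β e then F σ else 0 := by
  obtain ⟨C, h1, h2⟩ := exists_boundary_tensor B hF
  rw [← h2, ← sum_dualTensor_mul_regionMap hB C, readOp_apply]
  exact Finset.sum_congr rfl fun a _ => by rw [hφ, h1]

theorem eq_zero_of_readOp_eq_zero {B : Finset V} (hB : Λ.InjectiveRegion B)
    {φ : Conf Λ.physDim → ℂ} (hφ : IsContraction B φ) (h0 : ∀ β, Λ.readOp B β φ = 0) : φ = 0 := by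
  classical
  funext s
  obtain ⟨F, hF, hFφ⟩ := hφ s
  obtain ⟨C, h1, h2⟩ := exists_boundary_tensor B hF
  have hC : C = 0 := by
    funext ρ
    set β : Λ.VirtualConf := fun e =>
      if h : ∃ h' : Touches B e, ∃ v, v ∉ B ∧ v ∈ e.1 then ρ ⟨⟨e, h.1⟩, h.2⟩
      else ⟨0, Λ.bondDim_pos e⟩ with hβ
    have h3 : ρ = fun e : BoundaryEdge G B => β e.1.1 := by
      funext e
      simp only [hβ]
      rw [dif_pos ⟨e.1.2, e.2⟩]
    rw [h3, h2, ← readOp_eq_of_contraction hB β hF hFφ, h0]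
    rfl
  have h3 := hFφ (fun v => s v)
  rw [patch_restrict] at h3
  have h4 := h1 s (fun v => s v)
  rw [patch_restrict, hC] at h4
  rw [h3, h4]
  simp [regionMap]

theorem IsContraction.readOp {B B' : Finset V} (hB : Disjoint B B') (β : Λ.VirtualConf)
    {φ : Conf Λ.physDim → ℂ} (hφ : IsContraction B' φ) : IsContraction B' (Λ.readOp B β φ) := by
  intro s
  choose C hC hCφ using fun a : RegionConf Λ.physDim B => hφ (patch s a)
  refine ⟨fun σ => ∑ a, Λ.dualTensor B β a * C a σ, fun σ σ' h => ?_, fun a' => ?_⟩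
  · exact Finset.sum_congr rfl fun a _ => by rw [hC a σ σ' h]
  · simp only [Finset.sum_mul]
    rw [Finset.sum_comm, readOp_apply]
    refine Finset.sum_congr rfl fun a _ => ?_
    rw [← patch_comm hB, hCφ, Finset.mul_sum]
    refine Finset.sum_congr rfl fun σ _ => ?_
    rw [mul_assoc, weight_congr fun v hv => ?_]
    rw [patch_of_mem _ _ hv, patch_of_mem _ _ hv]

/-- Reading out two blocks. -/
theorem exists_readOp_readOp_eq {B B' : Finset V} (hBB : Disjoint B B')
    (hB : Λ.InjectiveRegion B) (hB' : Λ.InjectiveRegion B') {φ : Conf Λ.physDim → ℂ}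
    (hφ : IsContraction (B ∪ B') φ) (s : Conf Λ.physDim) :
    ∃ F : Λ.VirtualConf → ℂ, InnerIndep (B ∪ B') F ∧ ∀ β β' : Λ.VirtualConf,
      Λ.readOp B β (Λ.readOp B' β' φ) s =
        ∑ σ, if ∀ e, Touches B e → σ e = β e then
          (if ∀ e, Touches B' e → σ e = β' e then F σ else 0) else 0 := by
  obtain ⟨F, hF, hFφ⟩ := hφ s
  refine ⟨F, hF, fun β β' => ?_⟩
  refine readOp_eq_of_contraction hB β
    (innerIndep_ite hBB.symm β' (hF.mono Finset.subset_union_left)) fun a => ?_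
  rw [readOp_eq_of_contraction hB' β' (F := fun σ => F σ * Λ.weight B (patch s a) σ)
    ((hF.mono Finset.subset_union_right).mul (innerIndep_weight hBB _)) fun a' => ?_]
  · simp only [ite_mul, zero_mul]
  · have h1 : patch (patch s a) a' =
        patch s (fun v : {v // v ∈ B ∪ B'} => patch (patch s a) a' v) := by
      ext v
      by_cases hv : v ∈ B ∪ B'
      · rw [patch_of_mem (R := B ∪ B') _ _ hv]
      · have hv1 : v ∉ B := fun h => hv (Finset.mem_union_left _ h)
        have hv2 : v ∉ B' := fun h => hv (Finset.mem_union_right _ h)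
        rw [patch_of_notMem (R := B ∪ B') _ _ hv, patch_of_notMem _ _ hv2, patch_of_notMem _ _ hv1]
    have h2 := hFφ (fun v => patch (patch s a) a' v)
    rw [← h1] at h2
    rw [h2]
    refine Finset.sum_congr rfl fun σ _ => ?_
    rw [mul_assoc]
    congr 1
    rw [weight, Finset.prod_union hBB]
    congr 1
    exact weight_congr (fun v hv => patch_of_notMem _ _ (Finset.disjoint_left.1 hBB hv)) σ

theorem readOp_readOp_eq_zero {B B' : Finset V} (hBB : Disjoint B B')
    (hB : Λ.InjectiveRegion B) (hB' : Λ.InjectiveRegion B') {φ : Conf Λ.physDim → ℂ}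
    (hφ : IsContraction (B ∪ B') φ) {β β' : Λ.VirtualConf} {e : G.edgeSet} (he : Touches B e)
    (he' : Touches B' e) (hne : β e ≠ β' e) : Λ.readOp B β (Λ.readOp B' β' φ) = 0 := by
  funext s
  obtain ⟨F, -, hF⟩ := exists_readOp_readOp_eq hBB hB hB' hφ s
  rw [hF]
  refine Finset.sum_eq_zero fun σ _ => ?_
  split_ifs with h1 h2
  · exact absurd ((h1 e he).symm.trans (h2 e he')) hne
  · rfl
  · rfl

theorem mem_union_of_touches {B B' : Finset V} (hBB : Disjoint B B') {e : G.edgeSet}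
    (he : Touches B e) (he' : Touches B' e) {v : V} (hv : v ∈ e.1) : v ∈ B ∪ B' := by
  obtain ⟨x, hx, hxe⟩ := he
  obtain ⟨y, hy, hye⟩ := he'
  have hxy : x ≠ y := fun h => Finset.disjoint_left.1 hBB hx (h ▸ hy)
  rw [(Sym2.mem_and_mem_iff hxy).1 ⟨hxe, hye⟩, Sym2.mem_iff] at hv
  rcases hv with rfl | rfl
  · exact Finset.mem_union_left _ hx
  · exact Finset.mem_union_right _ hy

theorem readOp_readOp_update {B B' : Finset V} (hBB : Disjoint B B')
    (hB : Λ.InjectiveRegion B) (hB' : Λ.InjectiveRegion B') {φ : Conf Λ.physDim → ℂ}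
    (hφ : IsContraction (B ∪ B') φ) (β : Λ.VirtualConf) {e : G.edgeSet} (he : Touches B e)
    (he' : Touches B' e) (x : Fin (Λ.bondDim e)) :
    Λ.readOp B (Function.update β e x) (Λ.readOp B' (Function.update β e x) φ) =
      Λ.readOp B β (Λ.readOp B' β φ) := by
  funext s
  obtain ⟨F, hFi, hF⟩ := exists_readOp_readOp_eq hBB hB hB' hφ s
  have hFu : ∀ σ y, F (Function.update σ e y) = F σ := by
    intro σ y
    refine hFi _ _ fun e' he'' => Function.update_of_ne ?_ _ _
    rintro rfl
    obtain ⟨v, hv, hve⟩ := he''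
    exact hv (mem_union_of_touches hBB he he' hve)
  have hupd : ∀ (σ β' : Λ.VirtualConf) (y : Fin (Λ.bondDim e)) (W : Finset V),
      (∀ e', Touches W e' → σ e' = β' e') → ∀ e', Touches W e' →
        Function.update σ e y e' = Function.update β' e y e' := by
    intro σ β' y W h e' h'
    by_cases hee : e' = e
    · subst hee; simp
    · rw [Function.update_of_ne hee, Function.update_of_ne hee, h e' h']
  rw [hF, hF]
  simp only [← ite_and]
  rw [← Finset.sum_filter, ← Finset.sum_filter]
  refine Finset.sum_nbij' (fun σ => Function.update σ e (β e)) (fun σ => Function.update σ e x)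
    ?_ ?_ ?_ ?_ ?_
  · intro σ hσ
    obtain ⟨-, h1, h2⟩ := Finset.mem_filter.1 hσ
    refine Finset.mem_filter.2 ⟨Finset.mem_univ _, ?_, ?_⟩
    · simpa using hupd σ _ (β e) B h1
    · simpa using hupd σ _ (β e) B' h2
  · intro σ hσ
    obtain ⟨-, h1, h2⟩ := Finset.mem_filter.1 hσ
    exact Finset.mem_filter.2 ⟨Finset.mem_univ _, hupd σ _ x B h1, hupd σ _ x B' h2⟩
  · intro σ hσ
    obtain ⟨-, h1, -⟩ := Finset.mem_filter.1 hσ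
    have := h1 e he
    rw [Function.update_self] at this
    simp [← this]
  · intro σ hσ
    obtain ⟨-, h1, -⟩ := Finset.mem_filter.1 hσ
    simp [← h1 e he]
  · intro σ _
    rw [hFu]

end Contraction

end PEPS

namespace PEPS

section GroundState

set_option linter.unusedSectionVars false

variable {V : Type*} [Fintype V] [DecidableEq V] {G : SimpleGraph V} [DecidableRel G.Adj]
  {Λ : PEPS G}

theorem pairwise_commute_readOp {T : Finset (Finset V)}
    (hT : (T : Set (Finset V)).PairwiseDisjoint id) (β : Finset V → Λ.VirtualConf) :
    (T : Set (Finset V)).Pairwise (Function.onFun Commute fun B => Λ.readOp B (β B)) := by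
  intro B hB B' hB' hne
  have h : Disjoint B B' := hT hB hB' hne
  exact commute_readOp h _ _

variable (Λ) in
/-- Read out the boundary indices of all the blocks in `T`. -/
def readAll (T : Finset (Finset V)) (hT : (T : Set (Finset V)).PairwiseDisjoint id)
    (β : Finset V → Λ.VirtualConf) : Module.End ℂ (Conf Λ.physDim → ℂ) :=
  T.noncommProd (fun B => Λ.readOp B (β B)) (pairwise_commute_readOp hT β)

theorem readAll_empty (h) (β : Finset V → Λ.VirtualConf) : Λ.readAll ∅ h β = 1 :=
  Finset.noncommProd_empty _ _

theorem pairwiseDisjoint_erase {T : Finset (Finset V)}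
    (hT : (T : Set (Finset V)).PairwiseDisjoint id) (B : Finset V) :
    ((T.erase B : Finset (Finset V)) : Set (Finset V)).PairwiseDisjoint id :=
  hT.subset (Finset.coe_subset.2 (Finset.erase_subset _ _))

theorem readAll_congr {T : Finset (Finset V)} (hT : (T : Set (Finset V)).PairwiseDisjoint id)
    {β β' : Finset V → Λ.VirtualConf} (h : ∀ B ∈ T, Λ.readOp B (β B) = Λ.readOp B (β' B)) :
    Λ.readAll T hT β = Λ.readAll T hT β' :=
  Finset.noncommProd_congr rfl h _

theorem readAll_erase_mul {T : Finset (Finset V)} (hT : (T : Set (Finset V)).PairwiseDisjoint id)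
    {B : Finset V} (hB : B ∈ T) (β : Finset V → Λ.VirtualConf) :
    Λ.readAll T hT β = Λ.readAll (T.erase B) (pairwiseDisjoint_erase hT B) β * Λ.readOp B (β B) :=
  (Finset.noncommProd_erase_mul T hB (fun B => Λ.readOp B (β B)) _ _).symm

theorem mul_readAll_erase {T : Finset (Finset V)} (hT : (T : Set (Finset V)).PairwiseDisjoint id)
    {B : Finset V} (hB : B ∈ T) (β : Finset V → Λ.VirtualConf) :
    Λ.readAll T hT β = Λ.readOp B (β B) * Λ.readAll (T.erase B) (pairwiseDisjoint_erase hT B) β :=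
  (Finset.mul_noncommProd_erase T hB (fun B => Λ.readOp B (β B)) _ _).symm

theorem eq_zero_of_readAll_eq_zero (T : Finset (Finset V))
    (hT : (T : Set (Finset V)).PairwiseDisjoint id) (hinj : ∀ B ∈ T, Λ.InjectiveRegion B)
    {φ : Conf Λ.physDim → ℂ} (hφ : ∀ B ∈ T, IsContraction B φ)
    (h0 : ∀ β, Λ.readAll T hT β φ = 0) : φ = 0 := by
  induction T using Finset.induction_on generalizing φ with
  | empty =>
    have := h0 fun _ e => ⟨0, Λ.bondDim_pos e⟩
    simpa [readAll_empty] using this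
  | insert B T hBT ih =>
    have hTB := hT.subset (Finset.coe_subset.2 (Finset.subset_insert B T))
    refine eq_zero_of_readOp_eq_zero (hinj B (Finset.mem_insert_self _ _))
      (hφ B (Finset.mem_insert_self _ _)) fun γ => ?_
    refine ih hTB (fun B' hB' => hinj B' (Finset.mem_insert_of_mem hB')) (fun B' hB' => ?_)
      fun β => ?_
    · have hne : B ≠ B' := by
        rintro rfl
        exact hBT hB'
      have hdisj : Disjoint B B' :=
        hT (Finset.mem_insert_self _ _) (Finset.mem_insert_of_mem hB') hne
      exact (hφ B' (Finset.mem_insert_of_mem hB')).readOp hdisj γ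
    · have h1 := h0 (Function.update β B γ)
      rw [readAll, Finset.noncommProd_insert_of_notMem' _ _ _ _ hBT, Function.update_self,
        Module.End.mul_apply] at h1
      rw [← h1]
      refine congrFun (congrArg DFunLike.coe ?_) _
      refine Finset.noncommProd_congr rfl (fun B' hB' => ?_) _
      rw [Function.update_of_ne]
      rintro rfl
      exact hBT hB'

theorem readAll_state (T : Finset (Finset V)) (hT : (T : Set (Finset V)).PairwiseDisjoint id)
    (hinj : ∀ B ∈ T, Λ.InjectiveRegion B) (β : Finset V → Λ.VirtualConf) (s : Conf Λ.physDim) :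
    Λ.readAll T hT β Λ.state s = ∑ σ, if ∀ B ∈ T, ∀ e, Touches B e → σ e = β B e then
      Λ.weight (Finset.univ \ T.biUnion id) s σ else 0 := by
  induction T using Finset.induction_on generalizing s with
  | empty => simp [readAll_empty, state_apply]
  | insert B T hBT ih =>
    have hTB := hT.subset (Finset.coe_subset.2 (Finset.subset_insert B T))
    have hdisj : ∀ B' ∈ T, Disjoint B' B := fun B' hB' =>
      hT (Finset.mem_insert_of_mem hB') (Finset.mem_insert_self _ _) (by
        rintro rfl
        exact hBT hB')
    have hdisj' : Disjoint B (T.biUnion id) :=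
      ((Finset.disjoint_biUnion_left _ _ _).2 hdisj).symm
    rw [readAll, Finset.noncommProd_insert_of_notMem _ _ _ _ hBT, Module.End.mul_apply]
    rw [readOp_eq_of_contraction (hinj B (Finset.mem_insert_self _ _)) (β B)
      (F := fun σ => if ∀ B ∈ T, ∀ e, Touches B e → σ e = β B e then
        Λ.weight (Finset.univ \ (insert B T).biUnion id) s σ else 0)]
    · simp only [Finset.forall_mem_insert, ite_and]
    · intro σ σ' h
      have h1 : (∀ B ∈ T, ∀ e, Touches B e → σ e = β B e) ↔
          ∀ B ∈ T, ∀ e, Touches B e → σ' e = β B e := by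
        refine forall₂_congr fun B' hB' => forall_congr' fun e =>
          imp_congr_right fun ⟨v, hv, hve⟩ => ?_
        rw [h e ⟨v, Finset.disjoint_left.1 (hdisj B' hB') hv, hve⟩]
      have h2 : Λ.weight (Finset.univ \ (insert B T).biUnion id) s σ =
          Λ.weight (Finset.univ \ (insert B T).biUnion id) s σ' := by
        refine innerIndep_weight (Finset.disjoint_left.2 fun v hv hvB => ?_) s σ σ' h
        exact (Finset.mem_sdiff.1 hv).2
          (Finset.mem_biUnion.2 ⟨B, Finset.mem_insert_self _ _, hvB⟩)
      simp only [h1, h2]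
    · intro a
      refine (ih hTB (fun B' hB' => hinj B' (Finset.mem_insert_of_mem hB')) _).trans ?_
      refine Finset.sum_congr rfl fun σ _ => ?_
      rw [ite_mul, zero_mul]
      congr 1
      have hsub : B ⊆ Finset.univ \ T.biUnion id := fun v hv =>
        Finset.mem_sdiff.2 ⟨Finset.mem_univ _, Finset.disjoint_left.1 hdisj' hv⟩
      have hset : (Finset.univ \ T.biUnion id) \ B = Finset.univ \ (insert B T).biUnion id := by
        rw [Finset.biUnion_insert, id, sdiff_sdiff, sup_comm]
        rfl
      rw [← weight_sdiff_mul hsub, hset, weight_congr (U := Finset.univ \ _) fun v hv => ?_]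
      refine patch_of_notMem _ _ fun hvB => (Finset.mem_sdiff.1 hv).2 ?_
      exact Finset.mem_biUnion.2 ⟨B, Finset.mem_insert_self _ _, hvB⟩

variable {P : Finpartition (Finset.univ : Finset V)}

theorem readAll_state_const (hinj : ∀ B ∈ P.parts, Λ.InjectiveRegion B) (σ₀ : Λ.VirtualConf)
    (s : Conf Λ.physDim) : Λ.readAll P.parts P.disjoint (fun _ => σ₀) Λ.state s = 1 := by
  rw [readAll_state _ _ hinj, Fintype.sum_eq_single σ₀]
  · rw [if_pos fun _ _ _ _ => rfl, P.biUnion_parts, sdiff_self]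
    simp [weight]
  · intro σ hσ
    refine if_neg fun h => hσ (funext fun e => ?_)
    obtain ⟨v, hv⟩ : ∃ v, v ∈ e.1 := ⟨_, Sym2.out_fst_mem e.1⟩
    obtain ⟨B, hB, hvB⟩ := P.exists_mem (Finset.mem_univ v)
    exact h B hB e ⟨v, hvB, hv⟩

theorem readAll_apply_eq (β : Finset V → Λ.VirtualConf) (φ : Conf Λ.physDim → ℂ)
    (s s' : Conf Λ.physDim) :
    Λ.readAll P.parts P.disjoint β φ s = Λ.readAll P.parts P.disjoint β φ s' := by
  refine eq_of_forall_update_eq _ (fun s v x => ?_) s s'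
  obtain ⟨B, hB, hvB⟩ := P.exists_mem (Finset.mem_univ v)
  rw [mul_readAll_erase P.disjoint hB, Module.End.mul_apply, readOp_apply, readOp_apply]
  refine Finset.sum_congr rfl fun a _ => ?_
  have hpatch : patch (Function.update s v x) a = patch s a := by
    funext w
    by_cases hw : w ∈ B
    · rw [patch_of_mem _ _ hw, patch_of_mem _ _ hw]
    · rw [patch_of_notMem _ _ hw, patch_of_notMem _ _ hw, Function.update_of_ne]
      rintro rfl
      exact hw hvB
  rw [hpatch]

/-- A vector that is a contraction on the blocks and on the pairs of blocks joined by an edge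
vanishes, if one of its coefficients in the dual tensors does. -/
theorem eq_zero_of_isContraction (hinj : ∀ B ∈ P.parts, Λ.InjectiveRegion B)
    {φ : Conf Λ.physDim → ℂ} (h1 : ∀ B ∈ P.parts, IsContraction B φ)
    (h2 : ∀ B ∈ P.parts, ∀ B' ∈ P.parts, B ≠ B' → ∀ e : G.edgeSet, Touches B e → Touches B' e →
      IsContraction (B ∪ B') φ) (σ₀ : Λ.VirtualConf) (s₀ : Conf Λ.physDim)
    (h0 : Λ.readAll P.parts P.disjoint (fun _ => σ₀) φ s₀ = 0) : φ = 0 := by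
  classical
  have hpair : ∀ B ∈ P.parts, ∀ B' ∈ P.parts, B ≠ B' → ∀ β : Finset V → Λ.VirtualConf,
      Λ.readAll P.parts P.disjoint β φ = Λ.readAll ((P.parts.erase B').erase B)
        (pairwiseDisjoint_erase (pairwiseDisjoint_erase P.disjoint B') B) β
          (Λ.readOp B (β B) (Λ.readOp B' (β B') φ)) := by
    intro B hB B' hB' hne β
    rw [readAll_erase_mul P.disjoint hB', readAll_erase_mul (pairwiseDisjoint_erase P.disjoint B')
      (Finset.mem_erase.2 ⟨hne, hB⟩)]
    rfl
  have htouch : ∀ {B B' : Finset V} {v : V}, B ∈ P.parts → B' ∈ P.parts → v ∈ B → v ∈ B' →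
      B = B' := fun hB hB' hv hv' => P.eq_of_mem_parts hB hB' hv hv'
  have hconst : ∀ σ : Λ.VirtualConf, Λ.readAll P.parts P.disjoint (fun _ => σ) φ s₀ = 0 := by
    intro σ
    rw [← h0]
    refine eq_of_forall_update_eq
      (fun σ : Λ.VirtualConf => Λ.readAll P.parts P.disjoint (fun _ => σ) φ s₀)
      (fun σ e x => ?_) σ σ₀
    change Λ.readAll P.parts P.disjoint (fun _ => Function.update σ e x) φ s₀ =
      Λ.readAll P.parts P.disjoint (fun _ => σ) φ s₀
    by_cases hex : ∃ B ∈ P.parts, ∃ B' ∈ P.parts, B ≠ B' ∧ Touches B e ∧ Touches B' e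
    · obtain ⟨B, hB, B', hB', hne, he, he'⟩ := hex
      have hdis : Disjoint B B' := P.disjoint hB hB' hne
      rw [hpair B hB B' hB' hne, hpair B hB B' hB' hne,
        readOp_readOp_update hdis (hinj B hB) (hinj B' hB') (h2 B hB B' hB' hne e he he') σ he he']
      refine congrFun (congrFun (congrArg DFunLike.coe ?_) _) _
      refine readAll_congr _ fun B'' hB'' => readOp_congr fun e' ⟨v, hv, hve⟩ _ => ?_
      rw [Function.update_of_ne]
      rintro rfl
      obtain ⟨hne1, hB''⟩ := Finset.mem_erase.1 hB''
      obtain ⟨hne2, hB''⟩ := Finset.mem_erase.1 hB''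
      rcases Finset.mem_union.1 (mem_union_of_touches hdis he he' hve) with hv' | hv'
      · exact hne1 (htouch hB'' hB hv hv')
      · exact hne2 (htouch hB'' hB' hv hv')
    · push Not at hex
      refine congrFun (congrFun (congrArg DFunLike.coe ?_) _) _
      refine readAll_congr _ fun B hB => readOp_congr fun e' he' ⟨v, hv, hve⟩ => ?_
      rw [Function.update_of_ne]
      rintro rfl
      obtain ⟨B', hB', hvB'⟩ := P.exists_mem (Finset.mem_univ v)
      refine hex B hB B' hB' ?_ he' v hvB' hve
      rintro rfl
      exact hv hvB'
  refine eq_zero_of_readAll_eq_zero P.parts P.disjoint hinj h1 fun β => ?_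
  by_cases hex : ∃ B ∈ P.parts, ∃ B' ∈ P.parts, B ≠ B' ∧
      ∃ e, Touches B e ∧ Touches B' e ∧ β B e ≠ β B' e
  · obtain ⟨B, hB, B', hB', hne, e, he, he', hβ⟩ := hex
    have hdis : Disjoint B B' := P.disjoint hB hB' hne
    rw [hpair B hB B' hB' hne, readOp_readOp_eq_zero hdis (hinj B hB)
      (hinj B' hB') (h2 B hB B' hB' hne e he he') he he' hβ, map_zero]
  · push Not at hex
    have hblock : ∀ e : G.edgeSet, ∃ B ∈ P.parts, Touches B e := fun e => by
      obtain ⟨B, hB, hvB⟩ := P.exists_mem (Finset.mem_univ (Quot.out e.1).1)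
      exact ⟨B, hB, _, hvB, Sym2.out_fst_mem e.1⟩
    choose b hb hbe using hblock
    have h3 : Λ.readAll P.parts P.disjoint β =
        Λ.readAll P.parts P.disjoint fun _ e => β (b e) e := by
      refine readAll_congr _ fun B hB => readOp_congr fun e he _ => ?_
      by_cases hBe : B = b e
      · rw [← hBe]
      · exact hex B hB (b e) (hb e) hBe e he (hbe e)
    funext s
    rw [h3, readAll_apply_eq _ _ s s₀, hconst]
    rfl

theorem nonempty_conf (hinj : ∀ B ∈ P.parts, Λ.InjectiveRegion B) :
    Nonempty (Conf Λ.physDim) := by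
  refine Classical.nonempty_pi.2 fun v => ?_
  by_contra hv
  rw [not_nonempty_iff] at hv
  obtain ⟨B, hB, hvB⟩ := P.exists_mem (Finset.mem_univ v)
  have h1 : (fun _ => 0 : Λ.BoundaryConf B → ℂ) = fun _ => 1 :=
    hinj B hB (funext fun a => hv.elim (a ⟨v, hvB⟩))
  exact zero_ne_one (congrFun h1 fun e => ⟨0, Λ.bondDim_pos _⟩)

theorem state_ne_zero (hinj : ∀ B ∈ P.parts, Λ.InjectiveRegion B) : Λ.state ≠ 0 := by
  intro h
  obtain ⟨s⟩ := nonempty_conf hinj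
  have h1 := readAll_state_const hinj (fun e => ⟨0, Λ.bondDim_pos e⟩) s
  rw [h] at h1
  have h2 : ((0 : StateSpace Λ.physDim) : Conf Λ.physDim → ℂ) = 0 := rfl
  rw [h2, map_zero] at h1
  exact zero_ne_one h1

theorem exists_blockAdj (hG : G.Connected) (hP : 2 ≤ P.parts.card) {B : Finset V}
    (hB : B ∈ P.parts) : ∃ B' ∈ P.parts, BlockAdj G B B' := by
  obtain ⟨B₁, hB₁, hne⟩ := Finset.exists_mem_ne hP B
  obtain ⟨v, hv⟩ := P.nonempty_of_mem_parts hB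
  obtain ⟨w, hw⟩ := P.nonempty_of_mem_parts hB₁
  have hwB : w ∉ B := fun h => hne (P.eq_of_mem_parts hB₁ hB hw h)
  obtain ⟨p⟩ := hG.preconnected v w
  obtain ⟨d, -, hd1, hd2⟩ := p.exists_boundary_dart (B : Set V) hv hwB
  obtain ⟨B', hB', hd⟩ := P.exists_mem (Finset.mem_univ d.snd)
  refine ⟨B', hB', ?_, d.fst, hd1, d.snd, hd, d.adj⟩
  rintro rfl
  exact hd2 hd

theorem blockAdj_of_touches {B B' : Finset V} (hBB : Disjoint B B') {e : G.edgeSet}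
    (he : Touches B e) (he' : Touches B' e) : ∃ v ∈ B, ∃ w ∈ B', G.Adj v w := by
  obtain ⟨x, hx, hxe⟩ := he
  obtain ⟨y, hy, hye⟩ := he'
  have hxy : x ≠ y := fun h => Finset.disjoint_left.1 hBB hx (h ▸ hy)
  refine ⟨x, hx, y, hy, ?_⟩
  have := e.2
  rwa [(Sym2.mem_and_mem_iff hxy).1 ⟨hxe, hye⟩, SimpleGraph.mem_edgeSet] at this

/-- The kernel of the parent Hamiltonian of an injective PEPS is spanned by the PEPS. -/
theorem ker_hamiltonian_eq_span (hG : G.Connected) (hP : Λ.IsInjectiveCovering P) {S : Type*}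
    [Fintype S] {R : S → Finset V} (hR : RangesCover G R P) :
    LinearMap.ker (toOp (hamiltonian (Λ.term R))).toLinearMap =
      Submodule.span ℂ {Λ.state} := by
  have hproj := isStarProjection_parentTerm Λ.state R
  apply le_antisymm
  · intro φ hφ
    have hφ0 : ∀ i, toOp (Λ.term R i) φ = 0 :=
      (toOp_hamiltonian_apply_eq_zero_iff hproj φ).1 hφ
    obtain ⟨s₀⟩ := nonempty_conf hP.2
    set σ₀ : Λ.VirtualConf := fun e => ⟨0, Λ.bondDim_pos e⟩
    set r := Λ.readAll P.parts P.disjoint (fun _ => σ₀) φ s₀ with hr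
    have hcon : ∀ i, ∀ U ⊆ R i, IsContraction U (φ.ofLp - r • Λ.state.ofLp) := fun i U hU =>
      (((isContraction_of_parentTerm R i (hφ0 i)).mono hU).sub_smul (isContraction_state U) r)
    have hzero : φ.ofLp - r • Λ.state.ofLp = 0 := by
      refine eq_zero_of_isContraction hP.2 (fun B hB => ?_)
        (fun B hB B' hB' hne e he he' => ?_) σ₀ s₀ ?_
      · obtain ⟨B', hB', hBB⟩ := exists_blockAdj hG hP.1 hB
        obtain ⟨i, hi, -⟩ := hR B hB B' hB' hBB
        exact hcon i B hi
      · obtain ⟨i, hi, hi'⟩ := hR B hB B' hB'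
          ⟨hne, blockAdj_of_touches (P.disjoint hB hB' hne) he he'⟩
        exact hcon i _ (Finset.union_subset hi hi')
      · rw [map_sub, map_smul, Pi.sub_apply, Pi.smul_apply, readAll_state_const hP.2, ← hr]
        simp
    refine Submodule.mem_span_singleton.2 ⟨r, ?_⟩
    apply WithLp.ofLp_injective
    exact (sub_eq_zero.1 hzero).symm
  · rw [Submodule.span_singleton_le_iff_mem]
    exact (toOp_hamiltonian_apply_eq_zero_iff hproj _).2
      (toOp_parentTerm_apply_self Λ.state R)

end GroundState

end PEPS

/-! ### Correlations and the gap -/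

section Gap

set_option linter.unusedSectionVars false

variable {ι : Type*} [Fintype ι] [DecidableEq ι] {S : Type*} [Fintype S] {H : S → Matrix ι ι ℂ}

theorem opDist_le_edist {O O' : Matrix ι ι ℂ} {i j : S} (hi : ¬ Commute O (H i))
    (hj : ¬ Commute O' (H j)) : opDist H O O' ≤ (interactionGraph H).edist i j :=
  (iInf_le _ i).trans <| (iInf_le _ j).trans <| (iInf_le _ hi).trans (iInf_le _ hj)

theorem connectedCorrelation_le (hH : ∀ i, IsStarProjection (H i)) {ψ : EuclideanSpace ℂ ι}
    (hψ : ψ ≠ 0)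
    (hker : LinearMap.ker (toOp (hamiltonian H)).toLinearMap = Submodule.span ℂ {ψ}) (g : ℕ)
    (hg : ∀ i, ((interactionGraph H).neighborSet i).ncard ≤ g) (O O' : Matrix ι ι ℂ) (m : ℕ)
    (hfar : ((2 * (g + 1) * m : ℕ) : ℕ∞) < opDist H O O') {θ : ℝ}
    (hθ : ((g : ℝ) + 1) ^ 2 * Real.sinh (θ / 2) ^ 2 ≤ spectralGap (hamiltonian H)) :
    connectedCorrelation ψ O O' ≤ (Real.cosh (m * θ))⁻¹ := by
  set φ : EuclideanSpace ℂ ι := ((‖ψ‖⁻¹ : ℝ) : ℂ) • ψ with hφ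
  have hφ1 : ‖φ‖ = 1 := by
    rw [hφ, norm_smul, Complex.norm_real, norm_inv, norm_norm, inv_mul_cancel₀]
    exact norm_ne_zero_iff.2 hψ
  have hφ0 : ∀ i, toOp (H i) φ = 0 := by
    refine (toOp_hamiltonian_apply_eq_zero_iff hH φ).1 ?_
    have : φ ∈ LinearMap.ker (toOp (hamiltonian H)).toLinearMap := by
      rw [hker]
      exact Submodule.smul_mem _ _ (Submodule.mem_span_singleton_self ψ)
    exact this
  have hgap : ∀ x, ⟪φ, x⟫_ℂ = 0 →
      spectralGap (hamiltonian H) * ‖x‖ ^ 2 ≤ ∑ i, ‖toOp (H i) x‖ ^ 2 := by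
    intro x hx
    have h1 := spectralGap_mul_norm_sq_le (posSemidef_hamiltonian hH) (x := x) fun y hy => ?_
    · rwa [inner_toOp_hamiltonian hH, Complex.ofReal_re] at h1
    · have hy' : y ∈ Submodule.span ℂ {ψ} := by
        rw [← hker]
        exact hy
      obtain ⟨r, rfl⟩ := Submodule.mem_span_singleton.1 hy'
      have h2 : ψ = (‖ψ‖ : ℂ) • φ := by
        rw [hφ, smul_smul, Complex.ofReal_inv, mul_inv_cancel₀, one_smul]
        exact_mod_cast norm_ne_zero_iff.2 hψ
      rw [inner_smul_left, h2, inner_smul_left, hx, mul_zero, mul_zero]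
  have hcomm : ∀ i j, ¬ (interactionGraph H).Adj i j → Commute (toOp (H i)) (toOp (H j)) := by
    intro i j hij
    rw [commute_toOp_iff]
    exact not_not.1 hij
  have key := norm_correlation_le (fun i => (hH i).toOp) hφ1 hφ0 hcomm g hg hgap (toOp O) (toOp O') m
    (fun i j hi hj => by
      rw [commute_toOp_iff] at hi hj
      exact hfar.trans_le (opDist_le_edist hi hj)) hθ
  rw [connectedCorrelation]
  refine div_le_of_le_mul₀ (by positivity) (inv_pos.2 (Real.cosh_pos _)).le ?_
  have hOO : toOp (O * O') φ = toOp O (toOp O' φ) := by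
    rw [toOp, map_mul]
    rfl
  have hOs : toOp Oᴴ = star (toOp O) := map_star _ O
  rw [← hφ, hOO, hOs]
  exact key

theorem hamiltonian_ne_zero (hH : ∀ i, IsStarProjection (H i)) (hL : linearSize H ≠ 0) :
    hamiltonian H ≠ 0 := by
  intro h0
  apply hL
  have h1 : ∀ i, H i = 0 := by
    intro i
    apply (Matrix.toEuclideanCLM (n := ι) (𝕜 := ℂ)).injective
    change toOp (H i) = toOp 0
    refine ContinuousLinearMap.ext fun x => ?_
    have h2 : toOp (hamiltonian H) x = 0 := by rw [h0, toOp, map_zero]; rfl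
    rw [(toOp_hamiltonian_apply_eq_zero_iff hH x).1 h2 i, toOp, map_zero]
    rfl
  have h2 : interactionGraph H = ⊥ := by
    ext i j
    simp [interactionGraph, h1]
  rw [linearSize, h2, SimpleGraph.diam_bot]

theorem spectralGap_nonneg (hH : ∀ i, IsStarProjection (H i)) : 0 ≤ spectralGap (hamiltonian H) :=
  Real.sInf_nonneg fun _ h => nonneg_of_hasEigenvalue (posSemidef_hamiltonian hH) h.2

theorem sinh_le_two_mul {y : ℝ} (hy0 : 0 ≤ y) (hy1 : y ≤ 1) : Real.sinh y ≤ 2 * y := by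
  have h1 := (abs_le.1 (Real.abs_exp_sub_one_sub_id_le (x := y) (by rwa [abs_of_nonneg hy0]))).2
  have h2 := Real.add_one_le_exp (-y)
  rw [Real.sinh_eq]
  nlinarith

/-- A gap whose correlation bound is compatible with algebraic correlations is at most of order
`(log L / L) ^ 2`. -/
theorem le_log_sq_div_sq_of_forall {γ A B α G L b : ℝ} (hA : 0 < A) (hB : 0 < B) (hα : 0 ≤ α)
    (hG : 0 < G) (hL : 0 < L) (hγ : 0 ≤ γ) (hLA : 2 ≤ A * L / (4 * G))
    (hLB : Real.log (2 / B) ≤ Real.log L)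
    (hLlog : 4 * G * (α + 1) / A * (Real.log L / L) ≤ 1) (hb : B * L ^ (-α) ≤ b)
    (h : ∀ m : ℕ, 2 * G * m < A * L → ∀ θ, G ^ 2 * Real.sinh (θ / 2) ^ 2 ≤ γ →
      b ≤ (Real.cosh (m * θ))⁻¹) :
    γ ≤ (2 * G * (4 * G * (α + 1) / A)) ^ 2 * Real.log L ^ 2 / L ^ 2 := by
  set m := ⌊A * L / (4 * G)⌋₊ with hm
  set t := Real.arsinh (√γ / G) with ht
  have ht0 : 0 ≤ t := Real.arsinh_nonneg_iff.2 (by positivity)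
  have hmle : (m : ℝ) ≤ A * L / (4 * G) := Nat.floor_le (by positivity)
  have hmge : A * L / (8 * G) ≤ m := by
    have h1 := Nat.lt_floor_add_one (A * L / (4 * G))
    have h2 : A * L / (8 * G) = A * L / (4 * G) / 2 := by field_simp; norm_num
    rw [h2]
    linarith
  have hmpos : (0 : ℝ) < m := lt_of_lt_of_le (by positivity) hmge
  have hfar : 2 * G * m < A * L := by
    calc 2 * G * m ≤ 2 * G * (A * L / (4 * G)) := by gcongr
      _ = A * L / 2 := by field_simp; norm_num
      _ < A * L := half_lt_self (by positivity)
  have h1 := h m hfar (2 * t) (by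
    rw [mul_div_cancel_left₀ t two_ne_zero, ht, Real.sinh_arsinh, div_pow, Real.sq_sqrt hγ,
      mul_div_cancel₀ γ (by positivity)])
  have h2 : (Real.cosh (m * (2 * t)))⁻¹ ≤ 2 * Real.exp (-(m * (2 * t))) := by
    have h3 : Real.exp (m * (2 * t)) / 2 ≤ Real.cosh (m * (2 * t)) := by
      rw [Real.cosh_eq]
      have := Real.exp_pos (-(m * (2 * t)))
      linarith
    rw [Real.exp_neg]
    calc _ ≤ (Real.exp (m * (2 * t)) / 2)⁻¹ := inv_anti₀ (by positivity) h3
      _ = _ := by rw [inv_div, div_eq_mul_inv]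
  have h3 : Real.log B - α * Real.log L ≤ Real.log 2 - m * (2 * t) := by
    have h4 := Real.log_le_log (by positivity) (hb.trans (h1.trans h2))
    rw [Real.log_mul hB.ne' (by positivity), Real.log_rpow hL,
      Real.log_mul two_ne_zero (Real.exp_pos _).ne', Real.log_exp] at h4
    linarith
  rw [Real.log_div two_ne_zero hB.ne'] at hLB
  have h4 : m * (2 * t) ≤ (α + 1) * Real.log L := by linarith
  set y := 4 * G * (α + 1) / A * (Real.log L / L) with hy
  have hty : t ≤ y := by
    have h5 : A * L / (8 * G) * (2 * t) ≤ (α + 1) * Real.log L :=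
      (mul_le_mul_of_nonneg_right hmge (by positivity)).trans h4
    have h6 : A * L / (8 * G) * (2 * y) = (α + 1) * Real.log L := by
      rw [hy]; field_simp; norm_num
    rw [← h6] at h5
    have := le_of_mul_le_mul_left h5 (by positivity)
    linarith
  have h7 : √γ / G ≤ 2 * y := by
    rw [← Real.sinh_arsinh (√γ / G), ← ht]
    exact (Real.sinh_le_sinh.2 hty).trans (sinh_le_two_mul (ht0.trans hty) hLlog)
  rw [div_le_iff₀ hG] at h7
  calc γ = √γ ^ 2 := (Real.sq_sqrt hγ).symm
    _ ≤ (2 * y * G) ^ 2 := by gcongr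
    _ = _ := by rw [hy]; field_simp

end Gap

/-- An upper bound of order `(log L / L) ^ 2` on the gap implies that the dynamical exponent is
at least two. -/
theorem HasDynamicalExponent.two_le {gap L : ℕ → ℝ} {C z : ℝ} (hC : 0 < C)
    (hL : Tendsto L atTop atTop) (hpos : ∀ᶠ n in atTop, 0 < gap n)
    (hle : ∀ᶠ n in atTop, gap n ≤ C * Real.log (L n) ^ 2 / L n ^ 2)
    (hz : HasDynamicalExponent gap L z) : 2 ≤ z := by
  have hlog : Tendsto (fun n => Real.log (L n)) atTop atTop := Real.tendsto_log_atTop.comp hL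
  have h1 : Tendsto (fun n => 2 - Real.log C / Real.log (L n) -
      2 * (Real.log (Real.log (L n)) / Real.log (L n))) atTop (𝓝 (2 - 0 - 2 * 0)) := by
    refine (tendsto_const_nhds.sub (tendsto_const_nhds.div_atTop hlog)).sub
      (Tendsto.const_mul 2 ?_)
    exact Real.isLittleO_log_id_atTop.tendsto_div_nhds_zero.comp hlog
  rw [mul_zero, sub_zero, sub_zero] at h1
  refine le_of_tendsto_of_tendsto h1 hz ?_
  filter_upwards [hpos, hle, hL.eventually_gt_atTop 0, hlog.eventually_gt_atTop 0] with n h2 h3 h4 h5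
  have h6 := Real.log_le_log h2 h3
  rw [Real.log_div (by positivity) (by positivity), Real.log_mul hC.ne' (by positivity),
    Real.log_pow, Real.log_pow] at h6
  push_cast at h6
  rw [le_div_iff₀ h5]
  have h7 : (2 - Real.log C / Real.log (L n) -
      2 * (Real.log (Real.log (L n)) / Real.log (L n))) * Real.log (L n) =
      2 * Real.log (L n) - Real.log C - 2 * Real.log (Real.log (L n)) := by
    field_simp
  rw [h7]
  linarith

end

theorem mainTheorem6
    -- a sequence of injective PEPS on finite connected graphs
    {V : ℕ → Type*} [∀ n, Fintype (V n)] [∀ n, DecidableEq (V n)]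
    (G : ∀ n, SimpleGraph (V n)) [∀ n, DecidableRel (G n).Adj]
    (hG : ∀ n, (G n).Connected)
    (Λ : ∀ n, PEPS (G n))
    (P : ∀ n, Finpartition (Finset.univ : Finset (V n)))
    (hP : ∀ n, (Λ n).IsInjectiveCovering (P n))
    -- sufficiently large interaction ranges
    {S : ℕ → Type*} [∀ n, Fintype (S n)]
    (R : ∀ n, S n → Finset (V n))
    (hR : ∀ n, PEPS.RangesCover (G n) (R n) (P n))
    -- locality, connectedness of the interaction graphs, growing linear size
    (g : ℕ)
    (hg : ∀ n i, ((interactionGraph ((Λ n).term (R n))).neighborSet i).ncard ≤ g)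
    (hconn : ∀ n, (interactionGraph ((Λ n).term (R n))).Connected)
    (hL : Tendsto (fun n => linearSize ((Λ n).term (R n))) atTop atTop)
    -- algebraic correlations of local operators in the ground state
    (O O' : ∀ n, Matrix (Conf (Λ n).physDim) (Conf (Λ n).physDim) ℂ)
    (k : ℕ)
    (hO : ∀ n, ∃ X : Finset (V n), X.card ≤ k ∧ IsSupportedOn (O n) X)
    (hO' : ∀ n, ∃ X : Finset (V n), X.card ≤ k ∧ IsSupportedOn (O' n) X)
    (A B α : ℝ) (hA : 0 < A) (hB : 0 < B) (hα : 0 ≤ α)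
    (hdist : ∀ᶠ n in atTop, ENNReal.ofReal (A * linearSize ((Λ n).term (R n))) ≤
      (opDist ((Λ n).term (R n)) (O n) (O' n) : ENNReal))
    (hcorr : ∀ᶠ n in atTop, B * (linearSize ((Λ n).term (R n)) : ℝ) ^ (-α) ≤
      connectedCorrelation (Λ n).state (O n) (O' n)) :
    (∀ n, (Λ n).state ≠ 0 ∧
      LinearMap.ker (toOp (hamiltonian ((Λ n).term (R n)))).toLinearMap =
        Submodule.span ℂ {(Λ n).state}) ∧
    -- the gap closes at least as fast as `L⁻²`, up to logarithms
    (∃ C : ℝ, ∀ᶠ n in atTop, spectralGap (hamiltonian ((Λ n).term (R n))) ≤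
      C * Real.log (linearSize ((Λ n).term (R n))) ^ 2 /
        (linearSize ((Λ n).term (R n)) : ℝ) ^ 2) ∧
    -- the dynamical exponent is at least two
    (∀ z : ℝ, HasDynamicalExponent
      (fun n => spectralGap (hamiltonian ((Λ n).term (R n))))
      (fun n => (linearSize ((Λ n).term (R n)) : ℝ)) z → 2 ≤ z) := by
  have hproj : ∀ n i, IsStarProjection ((Λ n).term (R n) i) := fun n i =>
    isStarProjection_parentTerm (Λ n).state (R n) i
  have hne : ∀ n, (Λ n).state ≠ 0 := fun n => PEPS.state_ne_zero (hP n).2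
  have hker := fun n => PEPS.ker_hamiltonian_eq_span (hG n) (hP n) (hR n)
  set L : ℕ → ℝ := fun n => (linearSize ((Λ n).term (R n)) : ℝ) with hLdef
  have hL' : Tendsto L atTop atTop := tendsto_natCast_atTop_atTop.comp hL
  have hlog : Tendsto (fun n => Real.log (L n)) atTop atTop := Real.tendsto_log_atTop.comp hL'
  have hG0 : (0 : ℝ) < (g : ℝ) + 1 := by positivity
  have hratio : Tendsto (fun n => 4 * ((g : ℝ) + 1) * (α + 1) / A * (Real.log (L n) / L n)) atTop
      (𝓝 (4 * ((g : ℝ) + 1) * (α + 1) / A * 0)) :=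
    Tendsto.const_mul _ (Real.isLittleO_log_id_atTop.tendsto_div_nhds_zero.comp hL')
  rw [mul_zero] at hratio
  have hgap : ∀ᶠ n in atTop, spectralGap (hamiltonian ((Λ n).term (R n))) ≤
      (2 * ((g : ℝ) + 1) * (4 * ((g : ℝ) + 1) * (α + 1) / A)) ^ 2 * Real.log (L n) ^ 2 / L n ^ 2 := by
    filter_upwards [hdist, hcorr, hL'.eventually_gt_atTop 0,
      (hL'.const_mul_atTop (show 0 < A / (4 * ((g : ℝ) + 1)) by positivity)).eventually_ge_atTop 2,
      hlog.eventually_ge_atTop (Real.log (2 / B)),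
      hratio.eventually_le_const one_pos] with n h1 h2 h3 h4 h5 h6
    refine le_log_sq_div_sq_of_forall hA hB hα hG0 h3 (spectralGap_nonneg (hproj n))
      (by rwa [mul_div_right_comm]) h5 h6 h2 fun m hm θ hθ => ?_
    refine connectedCorrelation_le (hproj n) (hne n) (hker n) g (hg n) (O n) (O' n) m ?_ hθ
    have h7 : (((2 * (g + 1) * m : ℕ) : ℕ∞) : ENNReal) <
        (opDist ((Λ n).term (R n)) (O n) (O' n) : ENNReal) := by
      refine lt_of_lt_of_le ?_ h1
      rw [ENat.toENNReal_coe, ← ENNReal.ofReal_natCast]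
      refine (ENNReal.ofReal_lt_ofReal_iff (by positivity)).2 ?_
      push_cast
      exact hm
    exact ENat.toENNReal_lt.1 h7
  refine ⟨fun n => ⟨hne n, hker n⟩, ⟨_, hgap⟩, fun z hz => ?_⟩
  refine hz.two_le (by positivity) hL' ?_ hgap
  filter_upwards [hL.eventually_gt_atTop 0] with n hn
  exact spectralGap_pos (posSemidef_hamiltonian (hproj n)) (hamiltonian_ne_zero (hproj n) hn.ne')
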